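/- Consider turnstile streams of length at most $m$ over the coordinates $[n]$, $n\ge 1$: a stream is a sequence of updates $(i_t,\Delta_t)$ with $i_t\in[n]$ and $\Delta_t\in\{-M,\ldots,M\}$ an integer, and it induces the vector $x\in\mathbb{Z}^n$ with $x_i=\sum_{t:\,i_t=i}\Delta_t$. A one-pass streaming algorithm keeps a memory of finitely many bits. In each step (initialization, processing an update, reporting) it may use fresh fair random bits; random bits needed again later must be stored in the memory. The memory map of each step may depend arbitrarily on $n,m,M,p,T,c$. The space used is the number of memory bits plus the number of random bits available in a step. At the end the algorithm returns an index $i^*\in[n]$ or the failure symbol $\bot$. For $p\ge 0$ and $T>0$ let $G(z)=\min(T,|z|^p)$, where $G(0)=0$ also if $p=0$. Theorem. For every $c>0$ and every $\kappa\in\mathbb{R}$ there is a constant $C>0$, depending only on $c$ and $\kappa$, such that for all $p\ge 0$, $T>0$, $n\ge 1$ and all $m,M\le n^{\kappa}$ there is a one-pass streaming algorithm that uses at most $C\cdot\max(1,T)\cdot\log^2 n$ bits of space (so $O(T\log^2 n)$ bits when $T\ge 1$) and is a perfect $G$-sampler with success probability $0.99$: for every turnstile stream as above of length at most $m$ whose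 induced vector $x$ is not zero, \[\Pr[i^*\ne\bot]\ge 0.99\] and, for all $i\in[n]$, \[\left|\Pr[i^*=i\mid i^*\ne\bot]-\frac{G(x_i)}{\sum_{j\in[n]}G(x_j)}\right|\le n^{-c}.\] -/

import Mathlib

/-- An update `(i, Δ)` of a turnstile stream on a vector with `n` coordinates: coordinate `i`
changes by the integer `Δ ∈ {-M, …, M}`. -/
abbrev TurnstileUpdate (n M : ℕ) : Type := Fin n × Set.Icc (-(M : ℤ)) (M : ℤ)

/-- The vector induced by a turnstile stream: `x_i` is the sum of all `Δ_t` with `i_t = i`. -/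
def streamVector {n M : ℕ} (S : List (TurnstileUpdate n M)) (i : Fin n) : ℤ :=
  ((S.filter (fun u => u.1 = i)).map (fun u => (u.2 : ℤ))).sum

/-- A one-pass randomized streaming algorithm on turnstile streams, returning an index or the
failure symbol `⊥` (`none`). Between updates it remembers `memBits` bits and nothing else. In each
step (initialization, processing of one update, reporting) it may look at `coinBits` fresh fair
random bits; there is no random oracle, so random bits needed again later must be kept in the
memory. -/
structure StreamingSampler (n M : ℕ) where
  memBits : ℕ
  coinBits : ℕ
  init : (Fin coinBits → Bool) → (Fin memBits → Bool)
  update : (Fin memBits → Bool) → TurnstileUpdate n M → (Fin coinBits → Bool) →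
    (Fin memBits → Bool)
  report : (Fin memBits → Bool) → (Fin coinBits → Bool) → Option (Fin n)

namespace StreamingSampler

variable {n M : ℕ}

/-- The space used, in bits: the memory, and the random bits in use during a step. -/
def space (A : StreamingSampler n M) : ℕ := A.memBits + A.coinBits

/-- The fresh fair coins of one step. -/
noncomputable def coins (A : StreamingSampler n M) : PMF (Fin A.coinBits → Bool) :=
  PMF.uniformOfFintype _

/-- The distribution of the memory after reading a stream from a given memory content; fresh
independent coins are used for each update. -/
noncomputable def process (A : StreamingSampler n M) :
    (Fin A.memBits → Bool) → List (TurnstileUpdate n M) → PMF (Fin A.memBits → Bool)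
  | s, [] => PMF.pure s
  | s, u :: S => A.coins.bind fun w => A.process (A.update s u w) S

/-- The distribution of the output of the algorithm on a stream. -/
noncomputable def output (A : StreamingSampler n M) (S : List (TurnstileUpdate n M)) :
    PMF (Option (Fin n)) :=
  A.coins.bind fun w => (A.process (A.init w) S).bind fun s => A.coins.map (A.report s)

/-- The probability that the algorithm does not return `⊥`. -/
noncomputable def successProb (A : StreamingSampler n M) (S : List (TurnstileUpdate n M)) : ℝ :=
  1 - (A.output S none).toReal

/-- The probability that the algorithm returns `i`, conditioned on it not returning `⊥`. -/
noncomputable def condProb (A : StreamingSampler n M) (S : List (TurnstileUpdate n M))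
    (i : Fin n) : ℝ :=
  (A.output S (some i)).toReal / A.successProb S

/-- `A` is an `ε`-approximate `G`-sampler with success probability `q` and additive distortion
`n ^ (-c)` on turnstile streams of length at most `m`: for every such stream, with induced vector
`x`, the algorithm returns an index with probability at least `q`, and conditioned on that it
returns `i` with probability `(1 ± ε) G(x_i) / ∑ j, G(x_j) ± n ^ (-c)`. Vectors `x` for which
`∑ j, G(x_j)` vanishes have no target distribution and are left out. -/
def IsApproxSampler (A : StreamingSampler n M) (G : ℝ → ℝ) (ε c q : ℝ) (m : ℕ) : Prop :=
  ∀ S : List (TurnstileUpdate n M), S.length ≤ m →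
    0 < ∑ j, G (streamVector S j) →
      q ≤ A.successProb S ∧
      ∀ i : Fin n,
        |A.condProb S i - G (streamVector S i) / ∑ j, G (streamVector S j)| ≤
          ε * (G (streamVector S i) / ∑ j, G (streamVector S j)) + (n : ℝ) ^ (-c)

/-- A perfect `G`-sampler: the case `ε = 0`. -/
def IsPerfectSampler (A : StreamingSampler n M) (G : ℝ → ℝ) (c q : ℝ) (m : ℕ) : Prop :=
  A.IsApproxSampler G 0 c q m

end StreamingSampler

/-- The cap function `G(z) = min(T, |z|^p)`, with the convention `|0|^0 = 0` that is usual for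
`L_0`. -/
noncomputable def capFunction (T p z : ℝ) : ℝ :=
  if z = 0 then 0 else min T (|z| ^ p)

/-! Write g = G/T and τ = max(1, T). A nonzero integer z has |z|^p ≥ 1, so 1/τ ≤ g(z) ≤ 1. Let every
coordinate survive independently with probability ρ. The event that i is the only survivor in the
support of x has the same probability for every i in the support (`sum_isolated`). Accepting a sole
survivor with probability g(x_i) therefore outputs i with probability exactly proportional to
G(x_i), whatever ρ is.

One such cell costs one element of `ZMod q`: a random linear fingerprint identifies vectors with a
single nonzero entry, except with probability n(2B+1)/q (`exists_isolation_sketch`). If ρ = 2^(-t)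
is about 1/|supp x|, the cell succeeds with probability at least 1/(8τ). With about 64τ cells for
each of the O(log n) values of t, all fail with probability at most 1/256. Taking the first success
adds no bias, because all cells share the same conditional law (`exists_sketch_of_list`,
`exists_nearSampler_of_cells`). For polynomial q this is O(τ log n) cells of O(log n) bits.

The cells use far more randomness than can be stored. A Chernoff and union bound over all inputs
(`exists_sample_law_approx`) yields polynomially many fixed seeds whose uniform mixture is nearly as
good on every input. They are built into the algorithm, which stores only the O(log n)-bit name of
one (`exists_sampler_of_sketch`).

If T > n, the space bound allows storing x modulo q and sampling from it directly
(`exists_nearSampler_of_storing`). -/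

open Finset

/-! ### Finite laws with real weights -/

/-- The law of `f` under the weights `w`. -/
noncomputable def lawOf {Ω O : Type*} [Fintype Ω] (w : Ω → ℝ) (f : Ω → O) (o : O) : ℝ :=
  open Classical in ∑ ω, if f ω = o then w ω else 0

theorem lawOf_eq {Ω O : Type*} [Fintype Ω] [DecidableEq O] (w : Ω → ℝ) (f : Ω → O) (o : O) :
    lawOf w f o = ∑ ω, if f ω = o then w ω else 0 := by
  unfold lawOf
  exact Finset.sum_congr rfl fun ω _ => by congr

theorem lawOf_nonneg {Ω O : Type*} [Fintype Ω] {w : Ω → ℝ} (hw : ∀ ω, 0 ≤ w ω)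
    (f : Ω → O) (o : O) : 0 ≤ lawOf w f o := by
  classical
  exact Finset.sum_nonneg fun ω _ => by split_ifs <;> simp [hw]

theorem sum_lawOf {Ω O : Type*} [Fintype Ω] [Fintype O] (w : Ω → ℝ) (f : Ω → O) :
    ∑ o, lawOf w f o = ∑ ω, w ω := by
  classical
  unfold lawOf
  rw [Finset.sum_comm]
  simp

theorem lawOf_le_one {Ω O : Type*} [Fintype Ω] {w : Ω → ℝ} (hw : ∀ ω, 0 ≤ w ω)
    (h1 : ∑ ω, w ω = 1) (f : Ω → O) (o : O) : lawOf w f o ≤ 1 := by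
  classical
  rw [← h1]
  exact Finset.sum_le_sum fun ω _ => by split_ifs <;> simp [hw]

theorem abs_lawOf_sub_le {Ω O : Type*} [Fintype Ω] {w : Ω → ℝ} (hw : ∀ ω, 0 ≤ w ω)
    (f g : Ω → O) (o : O) (bad : Ω → Prop) [DecidablePred bad]
    (h : ∀ ω, ¬ bad ω → f ω = g ω) :
    |lawOf w f o - lawOf w g o| ≤ ∑ ω, if bad ω then w ω else 0 := by
  classical
  unfold lawOf
  rw [← Finset.sum_sub_distrib]
  refine (Finset.abs_sum_le_sum_abs _ _).trans (Finset.sum_le_sum fun ω _ => ?_)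
  by_cases hb : bad ω
  · rw [if_pos hb]
    split_ifs <;> simp [abs_of_nonneg (hw ω), hw ω]
  · rw [h ω hb]
    simp [hb]

/-- Marginals of a product measure. A random function with independent values serves as a seed that
fixes in advance the random decision for every possible argument. -/
theorem lawOf_pi_apply {X O : Type*} [Fintype X] [Fintype O] [DecidableEq X] (p : X → O → ℝ)
    (hp : ∀ x, ∑ o, p x o = 1) (x : X) (o : O) :
    lawOf (fun f : X → O => ∏ y, p y (f y)) (fun f => f x) o = p x o := by
  classical
  unfold lawOf
  have h1 : ∀ f : X → O, (if f x = o then ∏ y, p y (f y) else 0)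
      = ∏ y, (if y = x then (if f y = o then p y (f y) else 0) else p y (f y)) := by
    intro f
    by_cases hf : f x = o
    · rw [if_pos hf]
      refine Finset.prod_congr rfl fun y _ => ?_
      by_cases hy : y = x
      · subst hy; simp [hf]
      · simp [hy]
    · rw [if_neg hf]
      exact (Finset.prod_eq_zero (Finset.mem_univ x) (by simp [hf])).symm
  simp_rw [h1]
  rw [← Fintype.prod_sum (fun y b => if y = x then (if b = o then p y b else 0) else p y b),
    Finset.prod_eq_single x]
  · simp
  · intro y _ hy
    simp [hy, hp]
  · simp

theorem sum_pi_prod_eq_one {X O : Type*} [Fintype X] [Fintype O] [DecidableEq X] (p : X → O → ℝ)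
    (hp : ∀ x, ∑ o, p x o = 1) : ∑ f : X → O, ∏ y, p y (f y) = 1 := by
  rw [← Fintype.prod_sum]
  simp [hp]

/-! ### Sampling few seeds that work for all inputs -/

/-- Uses exp u ≤ 1 + u + u² for |u| ≤ 1; the linear term averages to zero. -/
theorem sum_mul_exp_le {Ω : Type*} [Fintype Ω] {w f : Ω → ℝ} (hw : ∀ ω, 0 ≤ w ω)
    (h1 : ∑ ω, w ω = 1) (hf : ∀ ω, |f ω| ≤ 1) (h0 : ∑ ω, w ω * f ω = 0) {l : ℝ}
    (hl : |l| ≤ 1) : ∑ ω, w ω * Real.exp (l * f ω) ≤ Real.exp (l ^ 2) := by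
  have h : ∀ ω, w ω * Real.exp (l * f ω) ≤ w ω + l * (w ω * f ω) + w ω * l ^ 2 := by
    intro ω
    have hx : |l * f ω| ≤ 1 := by
      rw [abs_mul]; exact mul_le_one₀ hl (abs_nonneg _) (hf ω)
    have := (abs_le.1 (Real.abs_exp_sub_one_sub_id_le hx)).2
    have h2 : (l * f ω) ^ 2 ≤ l ^ 2 := by
      rw [mul_pow]
      have : f ω ^ 2 ≤ 1 := (sq_le_one_iff_abs_le_one _).2 (hf ω)
      nlinarith [sq_nonneg l]
    have h3 : Real.exp (l * f ω) ≤ 1 + l * f ω + l ^ 2 := by linarith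
    calc _ ≤ w ω * (1 + l * f ω + l ^ 2) := mul_le_mul_of_nonneg_left h3 (hw ω)
      _ = _ := by ring
  calc _ ≤ ∑ ω, (w ω + l * (w ω * f ω) + w ω * l ^ 2) := Finset.sum_le_sum fun ω _ => h ω
    _ = 1 + l ^ 2 := by
        rw [Finset.sum_add_distrib, Finset.sum_add_distrib, ← Finset.mul_sum, ← Finset.sum_mul,
          h1, h0]; ring
    _ ≤ _ := by linarith [Real.add_one_le_exp (l ^ 2)]

/-- Finitely many centered bounded functions have simultaneously small sums over some sample. -/
theorem exists_sample_sum_le {Ω J ι : Type*} [Fintype Ω] [Fintype J] [Fintype ι]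
    {w : Ω → ℝ} (hw : ∀ ω, 0 ≤ w ω) (h1 : ∑ ω, w ω = 1) (f : J → Ω → ℝ)
    (hf : ∀ j ω, |f j ω| ≤ 1) (h0 : ∀ j, ∑ ω, w ω * f j ω = 0) {ε : ℝ} (hε : 0 < ε)
    (hε1 : ε ≤ 1) (hcard : 4 * Real.log (Fintype.card J) ≤ Fintype.card ι * ε ^ 2) :
    ∃ s : ι → Ω, ∀ j, ∑ k, f j (s k) ≤ Fintype.card ι * ε := by
  classical
  -- With this l, `hcard` gives log |J| + |ι| l² ≤ |ι| ε² / 2 = l |ι| ε, which is the Chernoff bound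
  -- needed at the end.
  set l := ε / 2 with hl
  have hl0 : 0 < l := by positivity
  have hl1 : |l| ≤ 1 := by rw [abs_of_pos hl0]; linarith
  have hW : ∑ s : ι → Ω, ∏ k, w (s k) = 1 := sum_pi_prod_eq_one (fun _ => w) fun _ => h1
  have hmgf : ∀ j, ∑ s : ι → Ω, (∏ k, w (s k)) * Real.exp (l * ∑ k, f j (s k))
      ≤ Real.exp (l ^ 2) ^ Fintype.card ι := by
    intro j
    have : ∀ s : ι → Ω, (∏ k, w (s k)) * Real.exp (l * ∑ k, f j (s k))
        = ∏ k, (w (s k) * Real.exp (l * f j (s k))) := by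
      intro s
      rw [Finset.prod_mul_distrib, Finset.mul_sum, Real.exp_sum]
    simp_rw [this]
    rw [← Fintype.prod_sum (fun _ : ι => fun ω => w ω * Real.exp (l * f j ω)),
      Finset.prod_const, Finset.card_univ]
    exact pow_le_pow_left₀ (Finset.sum_nonneg fun ω _ => mul_nonneg (hw ω) (Real.exp_pos _).le)
      (sum_mul_exp_le hw h1 (hf j) (h0 j) hl1) _
  have htot : ∑ s : ι → Ω, (∏ k, w (s k)) * ∑ j, Real.exp (l * ∑ k, f j (s k))
      ≤ ∑ s : ι → Ω, (∏ k, w (s k)) * (Fintype.card J * Real.exp (l ^ 2) ^ Fintype.card ι) := by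
    rw [← Finset.sum_mul, hW, one_mul]
    simp_rw [Finset.mul_sum (s := (univ : Finset J))]
    rw [Finset.sum_comm]
    calc _ ≤ ∑ _j : J, Real.exp (l ^ 2) ^ Fintype.card ι := Finset.sum_le_sum fun j _ => hmgf j
      _ = _ := by simp
  -- Some sample does not exceed the average. Summing the exponentials over j inside the average
  -- plays the role of the union bound.
  have hex : ∃ s : ι → Ω, ∑ j, Real.exp (l * ∑ k, f j (s k))
      ≤ Fintype.card J * Real.exp (l ^ 2) ^ Fintype.card ι := by
    by_contra! hcon
    have hne : ∃ s : ι → Ω, 0 < ∏ k, w (s k) := by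
      by_contra! h
      have : ∑ s : ι → Ω, ∏ k, w (s k) ≤ 0 := Finset.sum_nonpos fun s _ => h s
      linarith
    obtain ⟨s, hs⟩ := hne
    refine absurd htot (not_le.2 (Finset.sum_lt_sum (fun s _ => ?_) ⟨s, Finset.mem_univ _, ?_⟩))
    · exact mul_le_mul_of_nonneg_left (hcon s).le (Finset.prod_nonneg fun _ _ => hw _)
    · exact mul_lt_mul_of_pos_left (hcon s) hs
  obtain ⟨s, hs⟩ := hex
  refine ⟨s, fun j => ?_⟩
  have hJ : (0 : ℝ) < Fintype.card J := by
    have : Nonempty J := ⟨j⟩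
    exact_mod_cast Fintype.card_pos
  have hj : Real.exp (l * ∑ k, f j (s k)) ≤ Fintype.card J * Real.exp (l ^ 2) ^ Fintype.card ι :=
    (Finset.single_le_sum (f := fun j => Real.exp (l * ∑ k, f j (s k)))
      (fun _ _ => (Real.exp_pos _).le) (Finset.mem_univ j)).trans hs
  have hlog := Real.log_le_log (Real.exp_pos _) hj
  rw [Real.log_exp, Real.log_mul hJ.ne' (by positivity), Real.log_pow, Real.log_exp] at hlog
  have h2 : l * ∑ k, f j (s k) ≤ l * (Fintype.card ι * ε) := by
    rw [hl] at hlog ⊢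
    nlinarith
  exact le_of_mul_le_mul_left h2 hl0

/-- A few seeds suffice to approximate the law of the output on every input. -/
theorem exists_sample_law_approx {Ω X O ι : Type*} [Fintype Ω] [Fintype X] [Fintype O]
    [Fintype ι] [Nonempty ι] {w : Ω → ℝ} (hw : ∀ ω, 0 ≤ w ω) (h1 : ∑ ω, w ω = 1)
    (ψ : Ω → X → O) {ε : ℝ} (hε : 0 < ε) (hε1 : ε ≤ 1)
    (hcard : 4 * Real.log (2 * Fintype.card X * Fintype.card O) ≤ Fintype.card ι * ε ^ 2) :
    ∃ s : ι → Ω, ∀ x o,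
      |lawOf (fun _ => (Fintype.card ι : ℝ)⁻¹) (fun k => ψ (s k) x) o
        - lawOf w (fun ω => ψ ω x) o| ≤ ε := by
  classical
  set p : X → O → ℝ := fun x o => lawOf w (fun ω => ψ ω x) o with hp
  set u : X × O → Ω → ℝ := fun xo ω => (if ψ ω xo.1 = xo.2 then 1 else 0) - p xo.1 xo.2 with hu
  have hu1 : ∀ xo ω, |u xo ω| ≤ 1 := by
    intro xo ω
    have h0 : 0 ≤ p xo.1 xo.2 := lawOf_nonneg hw _ _
    have h2 : p xo.1 xo.2 ≤ 1 := lawOf_le_one hw h1 _ _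
    simp only [hu]
    rw [abs_le]
    split_ifs <;> constructor <;> linarith
  have hu0 : ∀ xo, ∑ ω, w ω * u xo ω = 0 := by
    intro xo
    simp only [hu, mul_sub, Finset.sum_sub_distrib, ← Finset.sum_mul, h1, one_mul, mul_ite,
      mul_one, mul_zero]
    refine sub_eq_zero.2 (Finset.sum_congr rfl fun ω _ => ?_)
    congr
  -- The Boolean selects the sign, so that the one-sided bound controls the absolute value; it
  -- accounts for the factor 2 in `hcard`.
  obtain ⟨s, hs⟩ := exists_sample_sum_le (J := (X × O) × Bool) (ι := ι) hw h1
    (fun j ω => if j.2 then u j.1 ω else - u j.1 ω)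
    (fun j ω => by split_ifs <;> simp [hu1])
    (fun j => by split_ifs <;> simp [hu0]) hε hε1 (by
      refine le_trans (le_of_eq ?_) hcard
      simp only [Fintype.card_prod, Fintype.card_bool]
      push_cast; congr 2; ring)
  refine ⟨s, fun x o => ?_⟩
  have hι : (0 : ℝ) < Fintype.card ι := by exact_mod_cast Fintype.card_pos
  have ha := hs ((x, o), true)
  have hb := hs ((x, o), false)
  simp only [if_true, Bool.false_eq_true, if_false, Finset.sum_neg_distrib] at ha hb
  have hsum : ∑ k, u (x, o) (s k) = Fintype.card ι *
      (lawOf (fun _ => (Fintype.card ι : ℝ)⁻¹) (fun k => ψ (s k) x) o - p x o) := by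
    simp only [hu, Finset.sum_sub_distrib, lawOf, mul_sub, Finset.mul_sum, Finset.sum_const,
      Finset.card_univ, nsmul_eq_mul]
    congr 1
    refine Finset.sum_congr rfl fun k _ => ?_
    split_ifs <;> simp [hι.ne']
  rw [hsum] at ha hb
  rw [abs_le]
  constructor
  · rw [← mul_neg] at hb
    linarith [le_of_mul_le_mul_left hb hι]
  · exact le_of_mul_le_mul_left ha hι

/-! ### Randomized linear sketches -/

/-- A linear sketch of vectors in `ℤ ^ n` with values in the group `V`, whose matrix `col` and
decoder depend on a seed drawn from `Ω` with probabilities `weight`. -/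
structure RandomSketch (n : ℕ) (Ω V : Type) [Fintype Ω] [AddCommGroup V] where
  weight : Ω → ℝ
  weight_nonneg : ∀ ω, 0 ≤ weight ω
  sum_weight : ∑ ω, weight ω = 1
  col : Ω → Fin n → V
  decode : Ω → V → Option (Fin n)

namespace RandomSketch

variable {n : ℕ} {Ω Ω' V V' : Type} [Fintype Ω] [Fintype Ω'] [AddCommGroup V] [AddCommGroup V']

/-- The decoded output on a vector, for a given seed. -/
def out (S : RandomSketch n Ω V) (x : Fin n → ℤ) (ω : Ω) : Option (Fin n) :=
  S.decode ω (∑ i, x i • S.col ω i)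

/-- The probability of an output. -/
noncomputable def prob (S : RandomSketch n Ω V) (x : Fin n → ℤ) (o : Option (Fin n)) : ℝ :=
  lawOf S.weight (S.out x) o

theorem prob_nonneg (S : RandomSketch n Ω V) (x : Fin n → ℤ) (o : Option (Fin n)) :
    0 ≤ S.prob x o := lawOf_nonneg S.weight_nonneg _ _

theorem prob_le_one (S : RandomSketch n Ω V) (x : Fin n → ℤ) (o : Option (Fin n)) :
    S.prob x o ≤ 1 := lawOf_le_one S.weight_nonneg S.sum_weight _ _

/-- Run two independent sketches and return the output of the second if the first one fails. -/
def orElse (S : RandomSketch n Ω V) (S' : RandomSketch n Ω' V') :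
    RandomSketch n (Ω × Ω') (V × V') where
  weight ω := S.weight ω.1 * S'.weight ω.2
  weight_nonneg ω := mul_nonneg (S.weight_nonneg _) (S'.weight_nonneg _)
  sum_weight := by
    rw [Fintype.sum_prod_type]
    simp [← Finset.mul_sum, S.sum_weight, S'.sum_weight]
  col ω i := (S.col ω.1 i, S'.col ω.2 i)
  decode ω v := (S.decode ω.1 v.1).or (S'.decode ω.2 v.2)

theorem orElse_out (S : RandomSketch n Ω V) (S' : RandomSketch n Ω' V') (x : Fin n → ℤ)
    (ω : Ω × Ω') : (S.orElse S').out x ω = (S.out x ω.1).or (S'.out x ω.2) := by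
  simp [out, orElse, Prod.fst_sum, Prod.snd_sum]

theorem orElse_prob_none (S : RandomSketch n Ω V) (S' : RandomSketch n Ω' V') (x : Fin n → ℤ) :
    (S.orElse S').prob x none = S.prob x none * S'.prob x none := by
  simp only [prob, lawOf_eq]
  rw [Finset.sum_mul_sum, Fintype.sum_prod_type]
  refine Finset.sum_congr rfl fun a _ => Finset.sum_congr rfl fun b _ => ?_
  rw [orElse_out]
  cases S.out x a <;> cases S'.out x b <;> simp [orElse]

theorem orElse_prob_some (S : RandomSketch n Ω V) (S' : RandomSketch n Ω' V') (x : Fin n → ℤ)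
    (i : Fin n) : (S.orElse S').prob x (some i)
      = S.prob x (some i) + S.prob x none * S'.prob x (some i) := by
  simp only [prob, lawOf_eq]
  have h : (∑ a, if S.out x a = some i then S.weight a else 0)
      = ∑ a, ∑ b, (if S.out x a = some i then S.weight a else 0) * S'.weight b := by
    simp [← Finset.mul_sum, S'.sum_weight]
  rw [Finset.sum_mul_sum, Fintype.sum_prod_type, h, ← Finset.sum_add_distrib]
  refine Finset.sum_congr rfl fun a _ => ?_
  rw [← Finset.sum_add_distrib]
  refine Finset.sum_congr rfl fun b _ => ?_
  rw [orElse_out]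
  cases S.out x a <;> cases S'.out x b <;> simp [orElse]

/-- The sketch that always fails. -/
def fail (n : ℕ) : RandomSketch n Unit Unit where
  weight _ := 1
  weight_nonneg _ := zero_le_one
  sum_weight := by simp
  col _ _ := ()
  decode _ _ := none

end RandomSketch

/-- Independent repetition: if for every parameter `t` some sketch into `G` succeeds with
probability close to `σ t x` and then returns `i` with probability close to `π x i`, then a
sketch into a power of `G` fails with probability close to `∏ t, (1 - σ t x)`, and otherwise its
output is still distributed like `π x`. -/
theorem exists_sketch_of_list {n : ℕ} {G : Type} [AddCommGroup G] [Fintype G] {τ : Type*}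
    (adm : (Fin n → ℤ) → Prop) (σ : τ → (Fin n → ℤ) → ℝ)
    (hσ0 : ∀ t x, adm x → 0 ≤ σ t x) (hσ1 : ∀ t x, adm x → σ t x ≤ 1)
    (π : (Fin n → ℤ) → Fin n → ℝ) {e : ℝ} (he : 0 ≤ e)
    (hcell : ∀ t, ∃ (Ω : Type) (_ : Fintype Ω) (S : RandomSketch n Ω G), ∀ x, adm x →
      |S.prob x none - (1 - σ t x)| ≤ e ∧ ∀ i, |S.prob x (some i) - σ t x * π x i| ≤ e)
    (ts : List τ) :
    ∃ (Ω V : Type) (_ : Fintype Ω) (_ : AddCommGroup V) (_ : Fintype V) (S : RandomSketch n Ω V),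
      Fintype.card V = Fintype.card G ^ ts.length ∧ ∀ x, adm x →
      |S.prob x none - (ts.map fun t => 1 - σ t x).prod| ≤ 2 * ts.length * e ∧
      ∀ i, |S.prob x (some i) - (1 - (ts.map fun t => 1 - σ t x).prod) * π x i|
        ≤ 2 * ts.length * e := by
  induction ts with
  | nil =>
    refine ⟨Unit, Unit, inferInstance, inferInstance, inferInstance, RandomSketch.fail n, by simp,
      fun x _ => ?_⟩
    simp [RandomSketch.prob, lawOf, RandomSketch.out, RandomSketch.fail]
  | cons t ts ih =>
    obtain ⟨Ω', V, i1, i2, i3, S', hcard, hS'⟩ := ih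
    obtain ⟨Ω, i4, S, hS⟩ := hcell t
    refine ⟨Ω × Ω', G × V, inferInstance, inferInstance, inferInstance, S.orElse S', ?_,
      fun x hx => ?_⟩
    · simp [Fintype.card_prod, hcard, pow_succ, mul_comm]
    obtain ⟨hn, hs⟩ := hS x hx
    obtain ⟨hn', hs'⟩ := hS' x hx
    set N := (ts.map fun t => 1 - σ t x).prod with hN
    have hl0 := hσ0 t x hx
    have hl1 := hσ1 t x hx
    rw [RandomSketch.orElse_prob_none, List.map_cons, List.prod_cons, ← hN, List.length_cons]
    push_cast
    -- Errors add up, since b and a' lie in [0, 1]. A new cell costs e for its own output and e for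
    -- its failure probability, hence the factor 2 in the bound.
    have key : ∀ {a a' b b' δ : ℝ}, |a - a'| ≤ e → 0 ≤ b → b ≤ 1 → 0 ≤ a' → a' ≤ 1 →
        |b - b'| ≤ δ → |a * b - a' * b'| ≤ e + δ := by
      intro a a' b b' δ h1 h2 h3 h4 h5 h6
      calc |a * b - a' * b'| = |(a - a') * b + a' * (b - b')| := by ring_nf
        _ ≤ |a - a'| * b + a' * |b - b'| := by
            refine (abs_add_le _ _).trans ?_
            rw [abs_mul, abs_mul, abs_of_nonneg h2, abs_of_nonneg h4]
        _ ≤ e * 1 + 1 * δ := by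
            gcongr
        _ = _ := by ring
    constructor
    · refine (key hn (S'.prob_nonneg x _) (S'.prob_le_one x _) (by linarith) (by linarith)
        hn').trans ?_
      linarith
    · intro i
      rw [RandomSketch.orElse_prob_some]
      have h1 := key hn (S'.prob_nonneg x (some i)) (S'.prob_le_one x _) (by linarith)
        (by linarith) (hs' i)
      have h2 := hs i
      rw [abs_le] at h1 h2 ⊢
      constructor <;> nlinarith

/-! ### Fingerprints -/

/-- Some element with the property `P`, if there is one. -/
noncomputable def pick {α : Type*} (P : α → Prop) : Option α :=
  open Classical in if h : ∃ a, P a then some h.choose else none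

theorem pick_spec {α : Type*} {P : α → Prop} {a : α} (h : pick P = some a) : P a := by
  unfold pick at h
  split_ifs at h with h'
  rw [← Option.some.inj h]
  exact h'.choose_spec

theorem pick_eq_some {α : Type*} {P : α → Prop} {a : α} (h : P a) (hu : ∀ b, P b → b = a) :
    pick P = some a := by
  unfold pick
  rw [dif_pos ⟨a, h⟩]
  exact congrArg some (hu _ (Exists.choose_spec ⟨a, h⟩))

/-- The only nonzero coordinate of a vector together with its value. -/
noncomputable def soleEntry {n : ℕ} (y : Fin n → ℤ) : Option (Fin n × ℤ) :=
  pick fun p => p.2 ≠ 0 ∧ y = Pi.single p.1 p.2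

theorem soleEntry_eq_some_iff {n : ℕ} (y : Fin n → ℤ) (p : Fin n × ℤ) :
    soleEntry y = some p ↔ p.2 ≠ 0 ∧ y = Pi.single p.1 p.2 := by
  refine ⟨fun h => pick_spec (P := fun p : Fin n × ℤ => p.2 ≠ 0 ∧ y = Pi.single p.1 p.2) h,
    fun h => pick_eq_some h ?_⟩
  rintro ⟨j, z⟩ ⟨hz, hy⟩
  obtain ⟨hp, hy'⟩ := h
  have h1 : j = p.1 := by
    by_contra hne
    have := congrFun (hy.symm.trans hy') j
    simp [Pi.single_eq_of_ne hne] at this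
    exact hz this
  have h2 := congrFun (hy.symm.trans hy') j
  rw [Pi.single_eq_same, h1, Pi.single_eq_same] at h2
  exact Prod.ext h1 h2

/-- The decoder: read a fingerprint as that of a vector with a single nonzero coordinate. -/
noncomputable def fingerprintDecode {n q : ℕ} (B : ℕ) (r : Fin n → ZMod q) (v : ZMod q) :
    Option (Fin n × ℤ) :=
  pick fun p => p.2 ≠ 0 ∧ |p.2| ≤ B ∧ v = p.2 • r p.1

/-- The fingerprint coefficients `r` do not separate `y` from some vector with at most one
nonzero coordinate. -/
def FingerprintCollision {n q : ℕ} (B : ℕ) (y : Fin n → ℤ) (r : Fin n → ZMod q) : Prop :=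
  ∃ p ∈ (univ : Finset (Fin n)) ×ˢ Finset.Icc (-(B : ℤ)) B,
    y - Pi.single p.1 p.2 ≠ 0 ∧ ∑ i, (y - Pi.single p.1 p.2 : Fin n → ℤ) i • r i = 0

theorem sum_sub_single_smul {n q : ℕ} (y : Fin n → ℤ) (r : Fin n → ZMod q) (j : Fin n) (z : ℤ) :
    ∑ i, (y - Pi.single j z : Fin n → ℤ) i • r i = ∑ i, y i • r i - z • r j := by
  simp only [Pi.sub_apply, sub_smul, Finset.sum_sub_distrib]
  congr 1
  rw [Finset.sum_eq_single j]
  · simp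
  · intro b _ hb
    simp [Pi.single_eq_of_ne hb]
  · simp

/-- Without a collision, a candidate matches the fingerprint only if it equals y. The predicates
under the two `pick`s then coincide, so even the failures agree. -/
theorem fingerprintDecode_eq {n q B : ℕ} {y : Fin n → ℤ} {r : Fin n → ZMod q}
    (hy : ∀ i, |y i| ≤ B) (h : ¬ FingerprintCollision B y r) :
    fingerprintDecode B r (∑ i, y i • r i) = soleEntry y := by
  unfold fingerprintDecode soleEntry
  congr 1
  funext ⟨j, z⟩
  simp only [eq_iff_iff, and_congr_right_iff]
  intro _
  constructor
  · rintro ⟨hB, he⟩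
    by_contra hne
    refine h ⟨(j, z), ?_, sub_ne_zero.2 hne, ?_⟩
    · simpa [abs_le] using hB
    · rw [sum_sub_single_smul, he, sub_self]
  · intro he
    constructor
    · simpa [he] using hy j
    · rw [← sub_eq_zero, ← sum_sub_single_smul, he]
      simp

/-- Translating the hyperplane along a coordinate i₀ with c i₀ ≠ 0 is injective: the linear form
takes the value c i₀ * s on the translate by s, so s and then r can be recovered. -/
theorem card_orthogonal_mul_le {n q : ℕ} [Fact q.Prime] (c : Fin n → ZMod q) (hc : c ≠ 0) :
    (univ.filter fun r : Fin n → ZMod q => ∑ i, c i * r i = 0).card * q ≤ q ^ n := by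
  obtain ⟨i₀, hi₀⟩ := Function.ne_iff.1 hc
  have hi₀ : c i₀ ≠ 0 := hi₀
  have h : ((univ.filter fun r : Fin n → ZMod q => ∑ i, c i * r i = 0)
      ×ˢ (univ : Finset (ZMod q))).card ≤ (univ : Finset (Fin n → ZMod q)).card := by
    refine Finset.card_le_card_of_injOn (fun p => p.1 + Pi.single i₀ p.2) (by simp) ?_
    rintro ⟨r, s⟩ hr ⟨r', s'⟩ hr' he
    simp only [Finset.coe_product, Set.mem_prod, Finset.coe_filter, Finset.mem_univ, true_and,
      Set.mem_ofPred_eq, Finset.coe_univ, Set.mem_univ, and_true] at hr hr'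
    have hsum : ∀ (r : Fin n → ZMod q) (s : ZMod q),
        ∑ i, c i * (r + Pi.single i₀ s : Fin n → ZMod q) i = ∑ i, c i * r i + c i₀ * s := by
      intro r s
      simp only [Pi.add_apply, mul_add, Finset.sum_add_distrib]
      congr 1
      rw [Finset.sum_eq_single i₀]
      · simp
      · intro b _ hb
        simp [Pi.single_eq_of_ne hb]
      · simp
    have he' : r + Pi.single i₀ s = r' + Pi.single i₀ s' := he
    have h1 := hsum r s
    rw [he', hsum, hr, hr', zero_add, zero_add] at h1
    have h2 : s' = s := mul_left_cancel₀ hi₀ h1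
    subst h2
    exact Prod.ext (add_right_cancel he') rfl
  simpa [Finset.card_product, ZMod.card, Finset.card_univ] using h

/-- The difference has entries of size at most 2B < q, so it remains nonzero modulo q. -/
theorem card_separation_failure_mul_le {n q B : ℕ} [Fact q.Prime] (hq : 2 * B < q)
    {y : Fin n → ℤ} (hy : ∀ i, |y i| ≤ B) {j : Fin n} {z : ℤ} (hz : |z| ≤ B)
    (h0 : y - Pi.single j z ≠ 0) :
    (univ.filter fun r : Fin n → ZMod q =>
      ∑ i, (y - Pi.single j z : Fin n → ℤ) i • r i = 0).card * q ≤ q ^ n := by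
  have hc : (fun i => (((y - Pi.single j z : Fin n → ℤ) i : ℤ) : ZMod q)) ≠ 0 := by
    intro hc
    refine h0 (funext fun i => ?_)
    have h1 := congrFun hc i
    simp only [Pi.zero_apply] at h1
    rw [ZMod.intCast_zmod_eq_zero_iff_dvd] at h1
    refine Int.eq_zero_of_abs_lt_dvd h1 ?_
    have h2 : |(Pi.single j z : Fin n → ℤ) i| ≤ B := by
      by_cases hi : i = j
      · subst hi; simpa using hz
      · simp [Pi.single_eq_of_ne hi]
    have h3 := hy i
    have h4 : |y i - (Pi.single j z : Fin n → ℤ) i| ≤ |y i| + |(Pi.single j z : Fin n → ℤ) i| :=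
      abs_sub _ _
    rw [Pi.sub_apply]
    omega
  simpa only [zsmul_eq_mul] using card_orthogonal_mul_le _ hc

theorem card_collision_mul_le {n q B : ℕ} [Fact q.Prime] (hq : 2 * B < q) {y : Fin n → ℤ}
    (hy : ∀ i, |y i| ≤ B) [DecidablePred fun r : Fin n → ZMod q => FingerprintCollision B y r] :
    (univ.filter fun r : Fin n → ZMod q => FingerprintCollision B y r).card * q
      ≤ n * (2 * B + 1) * q ^ n := by
  classical
  set P := ((univ : Finset (Fin n)) ×ˢ Finset.Icc (-(B : ℤ)) (B : ℤ)).filter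
    fun p => y - Pi.single p.1 p.2 ≠ 0 with hP
  set E : Fin n × ℤ → Finset (Fin n → ZMod q) := fun p =>
    univ.filter fun r => ∑ i, (y - Pi.single p.1 p.2 : Fin n → ℤ) i • r i = 0 with hE
  have hsub : (univ.filter fun r : Fin n → ZMod q => FingerprintCollision B y r) ⊆
      P.biUnion E := by
    intro r hr
    obtain ⟨p, hp, h1, h2⟩ := (Finset.mem_filter.1 hr).2
    exact Finset.mem_biUnion.2 ⟨p, Finset.mem_filter.2 ⟨hp, h1⟩,
      Finset.mem_filter.2 ⟨Finset.mem_univ _, h2⟩⟩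
  have hEp : ∀ p ∈ P, (E p).card * q ≤ q ^ n := by
    intro p hp
    obtain ⟨h1, h2⟩ := Finset.mem_filter.1 hp
    have h3 := Finset.mem_Icc.1 (Finset.mem_product.1 h1).2
    exact card_separation_failure_mul_le hq hy (abs_le.2 h3) h2
  have hPc : P.card ≤ n * (2 * B + 1) := by
    refine (Finset.card_filter_le _ _).trans (le_of_eq ?_)
    rw [Finset.card_product, Finset.card_univ, Fintype.card_fin, Int.card_Icc]
    congr 1
    omega
  calc _ ≤ (∑ p ∈ P, (E p).card) * q :=
        Nat.mul_le_mul_right _ ((Finset.card_le_card hsub).trans Finset.card_biUnion_le)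
    _ ≤ ∑ p ∈ P, q ^ n := by
        rw [Finset.sum_mul]; exact Finset.sum_le_sum hEp
    _ ≤ _ := by
        rw [Finset.sum_const, smul_eq_mul]
        exact Nat.mul_le_mul_right _ hPc

/-! ### One cell of the sketch -/

/-- Random acceptance of integers up to `B` with prescribed probabilities. -/
theorem exists_acceptance (B : ℕ) (g : ℤ → ℝ) (hg0 : ∀ z, 0 ≤ g z) (hg1 : ∀ z, g z ≤ 1) :
    ∃ (Ω : Type) (_ : Fintype Ω) (w : Ω → ℝ) (acc : Ω → ℤ → Bool), (∀ a, 0 ≤ w a) ∧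
      ∑ a, w a = 1 ∧ ∀ z : ℤ, |z| ≤ B → ∑ a, (if acc a z then w a else 0) = g z := by
  classical
  set p : Finset.Icc (-(B : ℤ)) (B : ℤ) → Bool → ℝ := fun z b => if b then g z else 1 - g z
    with hp
  have hp1 : ∀ z, ∑ b, p z b = 1 := fun z => by simp [hp]
  refine ⟨Finset.Icc (-(B : ℤ)) (B : ℤ) → Bool, inferInstance, fun f => ∏ z, p z (f z),
    fun f z => if h : z ∈ Finset.Icc (-(B : ℤ)) B then f ⟨z, h⟩ else false, fun f => ?_,
    sum_pi_prod_eq_one p hp1, fun z hz => ?_⟩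
  · refine Finset.prod_nonneg fun z _ => ?_
    simp only [hp]
    split_ifs
    · exact hg0 _
    · linarith [hg1 z]
  · have hz' : z ∈ Finset.Icc (-(B : ℤ)) B := by simpa [abs_le] using hz
    have := lawOf_pi_apply p hp1 ⟨z, hz'⟩ true
    rw [lawOf_eq] at this
    simp only [dif_pos hz']
    rw [this]
    simp [hp]

/-- The probability that a given nonzero coordinate of `x` is the only one to survive if every
coordinate survives independently with probability `ρ`. -/
noncomputable def isolationProb {n : ℕ} (ρ : ℝ) (x : Fin n → ℤ) : ℝ :=
  ρ * (1 - ρ) ^ ((univ.filter fun i => x i ≠ 0).card - 1)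

/-- The event is a product event: i contributes ρ, every other nonzero coordinate 1 - ρ, every zero
coordinate 1. That the result does not depend on i is what makes the sampler unbiased. -/
theorem sum_isolated {n : ℕ} (ρ : ℝ) (x : Fin n → ℤ) (i : Fin n) (hi : x i ≠ 0) :
    (∑ S : Fin n → Bool, if (S i = true ∧ ∀ j, j ≠ i → x j ≠ 0 → S j = false)
      then ∏ j, (if S j then ρ else 1 - ρ) else 0) = isolationProb ρ x := by
  have h : ∀ S : Fin n → Bool, (if (S i = true ∧ ∀ j, j ≠ i → x j ≠ 0 → S j = false)
      then ∏ j, (if S j then ρ else 1 - ρ) else 0)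
      = ∏ j, (if x j ≠ 0 ∧ S j ≠ decide (j = i) then 0 else if S j then ρ else 1 - ρ) := by
    intro S
    by_cases hS : S i = true ∧ ∀ j, j ≠ i → x j ≠ 0 → S j = false
    · rw [if_pos hS]
      refine Finset.prod_congr rfl fun j _ => ?_
      refine (if_neg ?_).symm
      rintro ⟨hj, hne⟩
      by_cases hji : j = i
      · subst hji; simp [hS.1] at hne
      · simp [hji, hS.2 j hji hj] at hne
    · rw [if_neg hS]
      symm
      rw [Finset.prod_eq_zero_iff]
      by_contra! hcon
      refine hS ⟨?_, fun j hj hxj => ?_⟩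
      · by_contra hSi
        exact hcon i (Finset.mem_univ _) (if_pos ⟨hi, by simpa using hSi⟩)
      · by_contra hSj
        exact hcon j (Finset.mem_univ _) (if_pos ⟨hxj, by simpa [hj] using hSj⟩)
  simp_rw [h]
  rw [← Fintype.prod_sum (fun j (b : Bool) =>
    if x j ≠ 0 ∧ b ≠ decide (j = i) then 0 else if b then ρ else 1 - ρ)]
  have h2 : ∀ j, (∑ b : Bool, if x j ≠ 0 ∧ b ≠ decide (j = i) then (0 : ℝ)
      else if b then ρ else 1 - ρ)
      = (if j = i then ρ else 1) * (if j ∈ (univ.filter fun i => x i ≠ 0).erase i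
        then (1 - ρ) else 1) := by
    intro j
    by_cases hj : j = i
    · subst hj; simp [hi]
    · by_cases hx : x j = 0 <;> simp [hj, hx]
  simp_rw [h2]
  rw [Finset.prod_mul_distrib, Finset.prod_ite_eq' univ i, Finset.prod_ite_mem,
    Finset.univ_inter, Finset.prod_const, Finset.card_erase_of_mem (by simp [hi])]
  simp [isolationProb]

theorem restrict_eq_single_iff {n : ℕ} (S : Fin n → Bool) (x : Fin n → ℤ) (i : Fin n) (z : ℤ)
    (hz : z ≠ 0) : (fun j => if S j then x j else 0) = Pi.single i z ↔
      x i = z ∧ S i = true ∧ ∀ j, j ≠ i → x j ≠ 0 → S j = false := by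
  constructor
  · intro h
    have h1 := congrFun h i
    simp only [Pi.single_eq_same] at h1
    split_ifs at h1 with hS
    · refine ⟨h1, hS, fun j hj hx => ?_⟩
      have h2 := congrFun h j
      by_contra hSj
      simp [Pi.single_eq_of_ne hj, hSj, hx] at h2
    · exact absurd h1.symm hz
  · rintro ⟨hx, hS, h⟩
    funext j
    by_cases hj : j = i
    · subst hj; simp [hS, hx]
    · rw [Pi.single_eq_of_ne hj]
      by_cases hxj : x j = 0
      · simp [hxj]
      · simp [h j hj hxj]

/-- Keep every coordinate independently with probability `ρ`, and recover a sole surviving entry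
`x i` from a fingerprint in `ZMod q`, accepting it with probability `g (x i)`. -/
theorem exists_isolation_sketch {n q B : ℕ} [Fact q.Prime] (hq : 2 * B < q) {ρ : ℝ} (hρ0 : 0 ≤ ρ)
    (hρ1 : ρ ≤ 1) (g : ℤ → ℝ) (hgz : g 0 = 0) (hg0 : ∀ z, 0 ≤ g z) (hg1 : ∀ z, g z ≤ 1) :
    ∃ (Ω : Type) (_ : Fintype Ω) (S : RandomSketch n Ω (ZMod q)), ∀ x : Fin n → ℤ,
      (∀ i, |x i| ≤ B) →
      |S.prob x none - (1 - isolationProb ρ x * ∑ i, g (x i))| ≤ n * (2 * B + 1) / q ∧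
      ∀ i, |S.prob x (some i) - isolationProb ρ x * g (x i)| ≤ n * (2 * B + 1) / q := by
  classical
  obtain ⟨Ωa, iΩ, wa, acc, hwa, hwa1, hacc⟩ := exists_acceptance B g hg0 hg1
  have hq0 : (0 : ℝ) < q := by exact_mod_cast (Fact.out : q.Prime).pos
  set bern : (Fin n → Bool) → ℝ := fun S => ∏ j, (if S j then ρ else 1 - ρ) with hbern
  have hbern0 : ∀ S, 0 ≤ bern S := fun S => Finset.prod_nonneg fun j _ => by
    split_ifs <;> linarith
  have hbern1 : ∑ S, bern S = 1 :=
    sum_pi_prod_eq_one (fun (_ : Fin n) (b : Bool) => if b then ρ else 1 - ρ) (by simp)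
  have hunif : ∑ _r : Fin n → ZMod q, ((q : ℝ) ^ n)⁻¹ = 1 := by
    simp [Finset.card_univ, ZMod.card, (pow_pos hq0 n).ne']
  set accept : Ωa → Option (Fin n × ℤ) → Option (Fin n) := fun a o =>
    o.bind fun p => if acc a p.2 then some p.1 else none with haccept
  set W : (Fin n → Bool) × (Fin n → ZMod q) × Ωa → ℝ := fun ω =>
    bern ω.1 * (((q : ℝ) ^ n)⁻¹ * wa ω.2.2) with hW
  have hW0 : ∀ ω, 0 ≤ W ω := fun ω =>
    mul_nonneg (hbern0 _) (mul_nonneg (by positivity) (hwa _))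
  -- Here v may depend on the survivor set, since the collision event does; the acceptance seed
  -- always factors out.
  have hprod : ∀ (u : (Fin n → Bool) → ℝ) (v : (Fin n → Bool) → (Fin n → ZMod q) → ℝ)
      (t : Ωa → ℝ),
      ∑ ω : (Fin n → Bool) × (Fin n → ZMod q) × Ωa, u ω.1 * (v ω.1 ω.2.1 * t ω.2.2)
        = (∑ S, u S * ∑ r, v S r) * ∑ a, t a := by
    intro u v t
    simp only [Fintype.sum_prod_type, ← Finset.mul_sum, ← Finset.sum_mul, ← mul_assoc]
  have hW1 : ∑ ω, W ω = 1 := by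
    rw [hprod bern (fun _ _ => ((q : ℝ) ^ n)⁻¹) wa, hunif, hwa1]
    simp [hbern1]
  refine ⟨(Fin n → Bool) × (Fin n → ZMod q) × Ωa, inferInstance,
    ⟨W, hW0, hW1, fun ω i => if ω.1 i then ω.2.1 i else 0,
      fun ω v => accept ω.2.2 (fingerprintDecode B ω.2.1 v)⟩, fun x hx => ?_⟩
  set S : RandomSketch n ((Fin n → Bool) × (Fin n → ZMod q) × Ωa) (ZMod q) :=
    ⟨W, hW0, hW1, fun ω i => if ω.1 i then ω.2.1 i else 0,
      fun ω v => accept ω.2.2 (fingerprintDecode B ω.2.1 v)⟩ with hS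
  set y : (Fin n → Bool) → Fin n → ℤ := fun s j => if s j then x j else 0 with hy
  have hyB : ∀ s i, |y s i| ≤ B := by
    intro s i
    simp only [hy]
    split_ifs
    · exact hx i
    · simp
  -- The same cell with access to the surviving vector itself. Its law is computed exactly, and the
  -- real cell differs from it only on collisions.
  set ideal : (Fin n → Bool) × (Fin n → ZMod q) × Ωa → Option (Fin n) :=
    fun ω => accept ω.2.2 (soleEntry (y ω.1)) with hideal
  have hout : ∀ ω, ¬ FingerprintCollision B (y ω.1) ω.2.1 → S.out x ω = ideal ω := by
    intro ω hω
    have h1 : ∑ i, x i • S.col ω i = ∑ i, y ω.1 i • ω.2.1 i := by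
      refine Finset.sum_congr rfl fun i _ => ?_
      simp only [hS, hy]
      split_ifs <;> simp
    simp only [RandomSketch.out, h1]
    exact congrArg (accept ω.2.2) (fingerprintDecode_eq (hyB ω.1) hω)
  have hbad : (∑ ω, if FingerprintCollision B (y ω.1) ω.2.1 then W ω else 0)
      ≤ n * (2 * B + 1) / q := by
    have h1 : ∀ ω : (Fin n → Bool) × (Fin n → ZMod q) × Ωa,
        (if FingerprintCollision B (y ω.1) ω.2.1 then W ω else 0) = bern ω.1 *
          ((if FingerprintCollision B (y ω.1) ω.2.1 then ((q : ℝ) ^ n)⁻¹ else 0) * wa ω.2.2) := by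
      intro ω; split_ifs <;> simp [hW]
    simp_rw [h1]
    rw [hprod bern (fun s r => if FingerprintCollision B (y s) r then ((q : ℝ) ^ n)⁻¹ else 0) wa,
      hwa1, mul_one]
    calc _ ≤ ∑ s, bern s * (n * (2 * B + 1) / q) := by
          refine Finset.sum_le_sum fun s _ => mul_le_mul_of_nonneg_left ?_ (hbern0 s)
          rw [← Finset.sum_filter, Finset.sum_const, nsmul_eq_mul, ← div_eq_mul_inv,
            div_le_div_iff₀ (pow_pos hq0 n) hq0]
          exact_mod_cast card_collision_mul_le hq (hyB s)
      _ = _ := by rw [← Finset.sum_mul, hbern1, one_mul]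
  have hclose : ∀ o, |S.prob x o - lawOf W ideal o| ≤ n * (2 * B + 1) / q := fun o =>
    (abs_lawOf_sub_le hW0 (S.out x) ideal o
      (fun ω => FingerprintCollision B (y ω.1) ω.2.1) hout).trans hbad
  have hsome : ∀ i, lawOf W ideal (some i) = isolationProb ρ x * g (x i) := by
    intro i
    have h1 : ∀ ω, ideal ω = some i ↔ (x i ≠ 0 ∧ ω.1 i = true ∧
        ∀ j, j ≠ i → x j ≠ 0 → ω.1 j = false) ∧ acc ω.2.2 (x i) = true := by
      intro ω
      simp only [hideal, haccept, Option.bind_eq_some_iff, soleEntry_eq_some_iff]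
      constructor
      · rintro ⟨⟨j, z⟩, ⟨hz, he⟩, h2⟩
        split_ifs at h2 with h3
        obtain rfl : j = i := Option.some.inj h2
        obtain ⟨h6, h4, h5⟩ := (restrict_eq_single_iff _ _ _ _ hz).1 he
        have h6 : x j = z := h6
        subst h6
        exact ⟨⟨hz, h4, h5⟩, h3⟩
      · rintro ⟨⟨hz, h4, h5⟩, h3⟩
        exact ⟨(i, x i), ⟨hz, (restrict_eq_single_iff _ _ _ _ hz).2 ⟨rfl, h4, h5⟩⟩, by simp [h3]⟩
    by_cases hxi : x i = 0
    · rw [lawOf_eq, hxi, hgz, mul_zero]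
      refine Finset.sum_eq_zero fun ω _ => if_neg fun h => ?_
      exact ((h1 ω).1 h).1.1 hxi
    · have h2 : ∀ ω : (Fin n → Bool) × (Fin n → ZMod q) × Ωa,
          (if ideal ω = some i then W ω else 0)
          = (if (ω.1 i = true ∧ ∀ j, j ≠ i → x j ≠ 0 → ω.1 j = false) then bern ω.1 else 0)
            * (((q : ℝ) ^ n)⁻¹ * if acc ω.2.2 (x i) then wa ω.2.2 else 0) := by
        intro ω
        simp only [h1, hxi, ne_eq, not_false_eq_true, true_and, ite_and, hW]
        split_ifs <;> simp
      rw [lawOf_eq]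
      simp_rw [h2]
      rw [hprod (fun s => if (s i = true ∧ ∀ j, j ≠ i → x j ≠ 0 → s j = false)
        then bern s else 0) (fun _ _ => ((q : ℝ) ^ n)⁻¹) (fun a => if acc a (x i) then wa a else 0),
        hunif, hacc _ (hx i)]
      simp only [mul_one]
      rw [← sum_isolated ρ x i hxi]
  have hnone : lawOf W ideal none = 1 - isolationProb ρ x * ∑ i, g (x i) := by
    have h1 := sum_lawOf W ideal
    rw [hW1, Fintype.sum_option] at h1
    simp_rw [hsome, ← Finset.mul_sum] at h1
    linarith
  exact ⟨hnone ▸ hclose none, fun i => hsome i ▸ hclose (some i)⟩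

/-! ### Sketches that sample almost perfectly -/

namespace RandomSketch

/-- On every nonzero vector with entries up to `B` the sketch fails with a small probability `N`
and otherwise returns `i` with probability proportional to `g (x i)`, up to errors `δ`. -/
def IsNearSampler {n : ℕ} {Ω V : Type} [Fintype Ω] [AddCommGroup V] (S : RandomSketch n Ω V)
    (g : ℤ → ℝ) (B : ℕ) (δ : ℝ) : Prop :=
  ∀ x : Fin n → ℤ, (∀ i, |x i| ≤ B) → x ≠ 0 → ∃ N : ℝ, 0 ≤ N ∧ N ≤ 1 / 256 ∧
    |S.prob x none - N| ≤ δ ∧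
    ∀ i, |S.prob x (some i) - (1 - N) * (g (x i) / ∑ j, g (x j))| ≤ δ

end RandomSketch

/-- For t = ⌊log₂ k⌋ + 2, where k is the support size, 1/4 ≤ ρk ≤ 1/2. Bernoulli's inequality then
gives (1 - ρ)^(k-1) ≥ 1/2. -/
theorem exists_isolationProb_ge {n l : ℕ} (hl : n < 2 ^ l) (x : Fin n → ℤ) (hx : x ≠ 0) :
    ∃ t ∈ Finset.range (l + 2),
      1 / 8 ≤ isolationProb (1 / 2 ^ t) x * (univ.filter fun i => x i ≠ 0).card := by
  set k := (univ.filter fun i => x i ≠ 0).card with hk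
  have hk1 : 1 ≤ k := by
    obtain ⟨i, hi⟩ := Function.ne_iff.1 hx
    exact Finset.card_pos.2 ⟨i, by simpa using hi⟩
  have hkn : k ≤ n := by simpa using Finset.card_le_univ (univ.filter fun i => x i ≠ 0)
  have h1 : 2 ^ Nat.log 2 k ≤ k := Nat.pow_log_le_self 2 (by omega)
  have h2 : k < 2 ^ (Nat.log 2 k + 1) := Nat.lt_pow_succ_log_self (by norm_num) k
  have h3 : Nat.log 2 k < l := Nat.log_lt_of_lt_pow (by omega) (by omega)
  refine ⟨Nat.log 2 k + 2, Finset.mem_range.2 (by omega), ?_⟩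
  set t := Nat.log 2 k + 2 with ht
  have h4 : (2 : ℝ) ^ t ≤ 4 * k := by
    have : 2 ^ t ≤ 4 * k := by rw [ht, pow_add]; omega
    exact_mod_cast this
  have h5 : (2 : ℝ) * k ≤ 2 ^ t := by
    have : 2 * k ≤ 2 ^ t := by rw [ht, pow_succ]; omega
    exact_mod_cast this
  have hk0 : (0 : ℝ) < k := by exact_mod_cast hk1
  have ht0 : (0 : ℝ) < 2 ^ t := by positivity
  set ρ : ℝ := 1 / 2 ^ t with hρ
  have hρ0 : 0 < ρ := by positivity
  have hρk : 1 / 4 ≤ ρ * k := by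
    rw [hρ, one_div_mul_eq_div, le_div_iff₀ ht0]; linarith
  have hρk' : ρ * k ≤ 1 / 2 := by
    rw [hρ, one_div_mul_eq_div, div_le_iff₀ ht0]; linarith
  have hk1' : (1 : ℝ) ≤ k := by exact_mod_cast hk1
  have hρ1 : ρ ≤ 1 / 2 := by nlinarith
  have hb := one_add_mul_le_pow (a := -ρ) (by linarith) (k - 1)
  have hb' : (1 : ℝ) / 2 ≤ (1 - ρ) ^ (k - 1) := by
    rw [← sub_eq_add_neg] at hb
    refine le_trans ?_ hb
    rw [Nat.cast_sub hk1]
    push_cast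
    nlinarith
  calc (1 : ℝ) / 8 = 1 / 4 * (1 / 2) := by norm_num
    _ ≤ (ρ * k) * (1 - ρ) ^ (k - 1) := by gcongr
    _ = _ := by rw [isolationProb]; ring

/-- The events that i alone survives are disjoint for different i in the support. -/
theorem isolationProb_mul_card_le_one {n : ℕ} (x : Fin n → ℤ) {ρ : ℝ} (h0 : 0 ≤ ρ) (h1 : ρ ≤ 1) :
    isolationProb ρ x * (univ.filter fun i => x i ≠ 0).card ≤ 1 := by
  have h2 : ∑ S : Fin n → Bool, ∏ j, (if S j then ρ else 1 - ρ) = 1 :=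
    sum_pi_prod_eq_one (fun (_ : Fin n) (b : Bool) => if b then ρ else 1 - ρ) (by simp)
  calc _ = ∑ i ∈ univ.filter fun i => x i ≠ 0, isolationProb ρ x := by
        rw [Finset.sum_const, nsmul_eq_mul, mul_comm]
    _ = ∑ i ∈ univ.filter fun i => x i ≠ 0, ∑ S : Fin n → Bool,
        if (S i = true ∧ ∀ j, j ≠ i → x j ≠ 0 → S j = false)
        then ∏ j, (if S j then ρ else 1 - ρ) else 0 :=
        Finset.sum_congr rfl fun i hi => (sum_isolated ρ x i (Finset.mem_filter.1 hi).2).symm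
    _ ≤ ∑ S : Fin n → Bool, ∏ j, (if S j then ρ else 1 - ρ) := by
        rw [Finset.sum_comm]
        refine Finset.sum_le_sum fun S _ => ?_
        have hp : 0 ≤ ∏ j, (if S j then ρ else 1 - ρ) := Finset.prod_nonneg fun j _ => by
          split_ifs <;> linarith
        by_cases hS : ∃ i ∈ univ.filter fun i => x i ≠ 0,
            (S i = true ∧ ∀ j, j ≠ i → x j ≠ 0 → S j = false)
        · obtain ⟨i, hi, hSi, hSj⟩ := hS
          rw [Finset.sum_eq_single_of_mem i hi]
          · split_ifs <;> simp [hp]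
          · intro j hj hji
            refine if_neg fun h => ?_
            simp [hSj j hji (Finset.mem_filter.1 hj).2] at h
        · push Not at hS
          refine le_trans (le_of_eq (Finset.sum_eq_zero fun i hi => if_neg fun h => ?_)) hp
          obtain ⟨j, h1, h2, h3⟩ := hS i hi h.1
          simp [h.2 j h1 h2] at h3
    _ = 1 := h2

theorem sum_eq_sum_support {n : ℕ} (g : ℤ → ℝ) (hgz : g 0 = 0) (x : Fin n → ℤ) :
    ∑ i, g (x i) = ∑ i ∈ univ.filter fun i => x i ≠ 0, g (x i) := by
  rw [Finset.sum_filter]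
  refine Finset.sum_congr rfl fun i _ => ?_
  split_ifs with h
  · rfl
  · rw [not_not.1 h, hgz]

theorem isolationProb_nonneg {n : ℕ} (x : Fin n → ℤ) {ρ : ℝ} (h0 : 0 ≤ ρ) (h1 : ρ ≤ 1) :
    0 ≤ isolationProb ρ x :=
  mul_nonneg h0 (pow_nonneg (by linarith) _)

/-- The right sampling rate depends on the unknown support size, so all rates are tried. Only one
has to be good; the others cannot distort the conditional law. -/
theorem exists_nearSampler_of_cells {n q B l R : ℕ} [Fact q.Prime] (hq : 2 * B < q)
    (hl : n < 2 ^ l) (g : ℤ → ℝ) (hgz : g 0 = 0) (hg1 : ∀ z, g z ≤ 1) {τ : ℝ} (hτ : 1 ≤ τ)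
    (hgτ : ∀ z, z ≠ 0 → 1 / τ ≤ g z) (hR : 64 * τ ≤ R) :
    ∃ (Ω V : Type) (_ : Fintype Ω) (_ : AddCommGroup V) (_ : Fintype V) (S : RandomSketch n Ω V),
      Fintype.card V = q ^ (R * (l + 2)) ∧
      S.IsNearSampler g B (2 * (R * (l + 2)) * (n * (2 * B + 1) / q)) := by
  have hτ0 : 0 < τ := by linarith
  have hg0 : ∀ z, 0 ≤ g z := by
    intro z
    by_cases hz : z = 0
    · rw [hz, hgz]
    · exact le_trans (by positivity) (hgτ z hz)
  have hρ0 : ∀ t : ℕ, (0 : ℝ) ≤ 1 / 2 ^ t := fun t => by positivity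
  have hρ1 : ∀ t : ℕ, (1 : ℝ) / 2 ^ t ≤ 1 := fun t => by
    rw [div_le_one (by positivity)]; exact one_le_pow₀ (by norm_num)
  set adm : (Fin n → ℤ) → Prop := fun x => (∀ i, |x i| ≤ B) ∧ x ≠ 0 with hadm
  set σ : ℕ → (Fin n → ℤ) → ℝ := fun t x => isolationProb (1 / 2 ^ t) x * ∑ i, g (x i) with hσ
  have hσ0 : ∀ t x, 0 ≤ σ t x := fun t x =>
    mul_nonneg (isolationProb_nonneg x (hρ0 t) (hρ1 t)) (Finset.sum_nonneg fun i _ => hg0 _)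
  have hσ1 : ∀ t x, σ t x ≤ 1 := by
    intro t x
    refine le_trans (mul_le_mul_of_nonneg_left ?_ (isolationProb_nonneg x (hρ0 t) (hρ1 t)))
      (isolationProb_mul_card_le_one x (hρ0 t) (hρ1 t))
    rw [sum_eq_sum_support g hgz]
    calc _ ≤ ∑ i ∈ univ.filter fun i => x i ≠ 0, (1 : ℝ) := Finset.sum_le_sum fun i _ => hg1 _
      _ = _ := by simp
  have hsum : ∀ x : Fin n → ℤ, 1 / τ * (univ.filter fun i => x i ≠ 0).card ≤ ∑ i, g (x i) := by
    intro x
    rw [sum_eq_sum_support g hgz]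
    calc _ = ∑ i ∈ univ.filter fun i => x i ≠ 0, 1 / τ := by
          rw [Finset.sum_const, nsmul_eq_mul, mul_comm]
      _ ≤ _ := Finset.sum_le_sum fun i hi => hgτ _ (Finset.mem_filter.1 hi).2
  have hpos : ∀ x, adm x → 0 < ∑ i, g (x i) := by
    rintro x ⟨_, hx⟩
    refine lt_of_lt_of_le ?_ (hsum x)
    obtain ⟨i, hi⟩ := Function.ne_iff.1 hx
    have : 0 < (univ.filter fun i => x i ≠ 0).card :=
      Finset.card_pos.2 ⟨i, by simpa using hi⟩
    positivity
  set ts : List ℕ := (List.replicate R (Finset.range (l + 2)).toList).flatten with hts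
  obtain ⟨Ω, V, i1, i2, i3, S, hcard, hS⟩ := exists_sketch_of_list (G := ZMod q) adm σ
    (fun t x _ => hσ0 t x) (fun t x _ => hσ1 t x) (fun x i => g (x i) / ∑ j, g (x j))
    (e := n * (2 * B + 1) / q) (by positivity)
    (fun t => by
      obtain ⟨Ω, i1, S, hS⟩ := exists_isolation_sketch (n := n) hq (hρ0 t) (hρ1 t) g hgz hg0 hg1
      refine ⟨Ω, i1, S, fun x hx => ⟨(hS x hx.1).1, fun i => ?_⟩⟩
      have h1 : σ t x * (g (x i) / ∑ j, g (x j)) = isolationProb (1 / 2 ^ t) x * g (x i) := by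
        have := (hpos x hx).ne'
        simp only [hσ]
        field_simp
      rw [h1]
      exact (hS x hx.1).2 i) ts
  have hlen : ts.length = R * (l + 2) := by simp [hts]
  refine ⟨Ω, V, i1, i2, i3, S, by rw [hcard, hlen, ZMod.card], fun x hxB hx0 => ?_⟩
  have hx : adm x := ⟨hxB, hx0⟩
  obtain ⟨h1, h2⟩ := hS x hx
  rw [hlen] at h1 h2
  push_cast at h1 h2
  set N := (ts.map fun t => 1 - σ t x).prod with hN
  have hN' : N = (∏ t ∈ Finset.range (l + 2), (1 - σ t x)) ^ R := by
    rw [hN, hts, List.map_flatten, List.prod_flatten]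
    simp
  have hP0 : 0 ≤ ∏ t ∈ Finset.range (l + 2), (1 - σ t x) :=
    Finset.prod_nonneg fun t _ => by linarith [hσ1 t x]
  refine ⟨N, by rw [hN']; exact pow_nonneg hP0 _, ?_, h1, h2⟩
  obtain ⟨t, ht, hiso⟩ := exists_isolationProb_ge hl x hx0
  have hσt : 1 / (8 * τ) ≤ σ t x := by
    calc 1 / (8 * τ) = 1 / 8 * (1 / τ) := by field_simp
      _ ≤ (isolationProb (1 / 2 ^ t) x * (univ.filter fun i => x i ≠ 0).card) * (1 / τ) := by
          gcongr
      _ = isolationProb (1 / 2 ^ t) x * (1 / τ * (univ.filter fun i => x i ≠ 0).card) := by ring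
      _ ≤ _ := mul_le_mul_of_nonneg_left (hsum x) (isolationProb_nonneg x (hρ0 t) (hρ1 t))
  have hP : ∏ t ∈ Finset.range (l + 2), (1 - σ t x) ≤ Real.exp (-(1 / (8 * τ))) := by
    -- Only the good rate t is used; the other factors are at most 1.
    rw [← Finset.mul_prod_erase _ _ ht]
    calc _ ≤ (1 - σ t x) * 1 := mul_le_mul_of_nonneg_left
          (Finset.prod_le_one (fun t _ => by linarith [hσ1 t x]) fun t _ => by
            linarith [hσ0 t x]) (by linarith [hσ1 t x])
      _ ≤ -(1 / (8 * τ)) + 1 := by linarith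
      _ ≤ _ := Real.add_one_le_exp _
  calc N ≤ Real.exp (-(1 / (8 * τ))) ^ R := hN' ▸ pow_le_pow_left₀ hP0 hP R
    _ = Real.exp (-(R / (8 * τ))) := by rw [← Real.exp_nat_mul]; ring_nf
    _ ≤ Real.exp (-8) := by
        rw [Real.exp_le_exp, neg_le_neg_iff, le_div_iff₀ (by positivity)]
        linarith
    _ = (Real.exp 1 ^ 8)⁻¹ := by rw [← Real.exp_nat_mul, ← Real.exp_neg]; norm_num
    _ ≤ ((2 : ℝ) ^ 8)⁻¹ := by
        gcongr
        linarith [Real.add_one_le_exp (1 : ℝ)]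
    _ = 1 / 256 := by norm_num

/-- Storing the vector modulo a prime allows to sample from it exactly. -/
theorem exists_nearSampler_of_storing {n q B : ℕ} [Fact q.Prime] (hq : 2 * B < q) (hn : 0 < n)
    (g : ℤ → ℝ) (hg0 : ∀ z, 0 ≤ g z) (hgp : ∀ z, z ≠ 0 → 0 < g z) :
    ∃ (Ω V : Type) (_ : Fintype Ω) (_ : AddCommGroup V) (_ : Fintype V) (S : RandomSketch n Ω V),
      Fintype.card V = q ^ n ∧ S.IsNearSampler g B 0 := by
  classical
  set X := Fin n → Finset.Icc (-(B : ℤ)) (B : ℤ) with hX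
  set W : X → ℝ := fun x => ∑ j, g (x j) with hW
  -- The uniform default only serves to make p x a probability vector when the weights vanish.
  set p : X → Fin n → ℝ := fun x i => if W x = 0 then 1 / n else g (x i) / W x with hp
  have hn' : (n : ℝ) ≠ 0 := by exact_mod_cast hn.ne'
  have hp1 : ∀ x, ∑ i, p x i = 1 := by
    intro x
    by_cases h : W x = 0
    · simp [hp, h, hn']
    · simp only [hp, h, if_false]
      rw [← Finset.sum_div, div_self h]
  have hp0 : ∀ x i, 0 ≤ p x i := by
    intro x i
    simp only [hp]
    split_ifs
    · positivity
    · exact div_nonneg (hg0 _) (Finset.sum_nonneg fun j _ => hg0 _)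
  -- The seed fixes an output for every possible vector, drawn from the target law of that vector.
  set S : RandomSketch n (X → Fin n) (Fin n → ZMod q) :=
    { weight := fun f => ∏ x, p x (f x)
      weight_nonneg := fun f => Finset.prod_nonneg fun x _ => hp0 _ _
      sum_weight := sum_pi_prod_eq_one p hp1
      col := fun _ i => Pi.single i 1
      decode := fun f v => (pick fun x : X => v = fun i => (((x i : ℤ)) : ZMod q)).map f } with hS
  refine ⟨X → Fin n, Fin n → ZMod q, inferInstance, inferInstance, inferInstance, S,
    by simp [ZMod.card], fun x hxB hx0 => ?_⟩
  set x' : X := fun i => ⟨x i, Finset.mem_Icc.2 (abs_le.1 (hxB i))⟩ with hx'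
  have hout : ∀ f, S.out x f = some (f x') := by
    intro f
    have hv : ∑ i, x i • S.col f i = fun i => ((x i : ℤ) : ZMod q) := by
      funext j
      simp [hS, Finset.sum_apply, Pi.single_apply]
    have hpick : (pick fun y : X => (fun i => ((x i : ℤ) : ZMod q))
        = fun i => (((y i : ℤ)) : ZMod q)) = some x' := by
      refine pick_eq_some rfl fun y hy => funext fun i => Subtype.ext ?_
      have h1 := congrFun hy i
      rw [ZMod.intCast_eq_intCast_iff_dvd_sub] at h1
      have h2 := Finset.mem_Icc.1 (y i).2
      have h3 := abs_le.1 (hxB i)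
      have h4 := Int.eq_zero_of_abs_lt_dvd h1 (by rw [abs_lt]; constructor <;> omega)
      change (y i : ℤ) = x i
      omega
    simp only [RandomSketch.out, hv]
    simp only [hS]
    rw [hpick]
    rfl
  have hpos : W x' ≠ 0 := by
    obtain ⟨i, hi⟩ := Function.ne_iff.1 hx0
    exact (Finset.sum_pos' (fun j _ => hg0 _) ⟨i, Finset.mem_univ _, hgp _ hi⟩).ne'
  refine ⟨0, le_rfl, by norm_num, ?_, fun i => ?_⟩
  · rw [RandomSketch.prob, lawOf_eq]
    simp [hout]
  · have h1 := lawOf_pi_apply p hp1 x' i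
    have h2 : S.prob x (some i) = p x' i := by
      rw [← h1, RandomSketch.prob, lawOf_eq, lawOf_eq]
      simp only [hout, Option.some.injEq]
      rfl
    rw [h2]
    simp only [hp, hpos, if_false]
    simp [hW, hx']

/-! ### From sketches to streaming algorithms -/

theorem streamVector_nil {n M : ℕ} (i : Fin n) :
    streamVector ([] : List (TurnstileUpdate n M)) i = 0 := by
  simp [streamVector]

theorem streamVector_cons {n M : ℕ} (u : TurnstileUpdate n M) (S : List (TurnstileUpdate n M))
    (i : Fin n) : streamVector (u :: S) i = (if i = u.1 then (u.2 : ℤ) else 0)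
      + streamVector S i := by
  unfold streamVector
  by_cases h : u.1 = i
  · simp [h]
  · simp [h, Ne.symm h]

theorem abs_streamVector_le {n M : ℕ} (S : List (TurnstileUpdate n M)) (i : Fin n) :
    |streamVector S i| ≤ S.length * M := by
  induction S with
  | nil => simp [streamVector_nil]
  | cons u S ih =>
    rw [streamVector_cons, List.length_cons]
    push_cast
    have h : |(if i = u.1 then (u.2 : ℤ) else 0)| ≤ M := by
      split_ifs
      · exact abs_le.2 u.2.2
      · simp
    calc _ ≤ |(if i = u.1 then (u.2 : ℤ) else 0)| + |streamVector S i| := abs_add_le _ _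
      _ ≤ M + S.length * M := add_le_add h ih
      _ = _ := by ring

theorem sum_streamVector_cons_smul {n M : ℕ} {V : Type*} [AddCommGroup V]
    (u : TurnstileUpdate n M) (S : List (TurnstileUpdate n M)) (col : Fin n → V) :
    ∑ i, streamVector (u :: S) i • col i
      = (u.2 : ℤ) • col u.1 + ∑ i, streamVector S i • col i := by
  simp_rw [streamVector_cons, add_smul]
  rw [Finset.sum_add_distrib]
  congr 1
  rw [Finset.sum_eq_single u.1]
  · simp
  · intro i _ hi
    simp [hi]
  · simp

theorem StreamingSampler.process_eq_pure {n M : ℕ} (A : StreamingSampler n M)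
    {upd : (Fin A.memBits → Bool) → TurnstileUpdate n M → (Fin A.memBits → Bool)}
    (h : ∀ s u w, A.update s u w = upd s u) (L : List (TurnstileUpdate n M))
    (s : Fin A.memBits → Bool) : A.process s L = PMF.pure (L.foldl upd s) := by
  induction L generalizing s with
  | nil => simp [StreamingSampler.process]
  | cons u L ih => simp [StreamingSampler.process, h, ih, PMF.bind_const]

theorem StreamingSampler.output_eq_map {n M : ℕ} (A : StreamingSampler n M)
    {upd : (Fin A.memBits → Bool) → TurnstileUpdate n M → (Fin A.memBits → Bool)}
    {rep : (Fin A.memBits → Bool) → Option (Fin n)} (h : ∀ s u w, A.update s u w = upd s u)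
    (h' : ∀ s w, A.report s w = rep s) (L : List (TurnstileUpdate n M)) :
    A.output L = A.coins.map fun w => rep (L.foldl upd (A.init w)) := by
  have hr : ∀ s, A.report s = Function.const _ (rep s) := fun s => funext (h' s)
  simp only [StreamingSampler.output, A.process_eq_pure h, PMF.pure_bind, hr, PMF.map_const]
  rfl

/-- Add an update to the encoded pair of a seed name and a sketch. -/
noncomputable def sketchUpdate {n M b k : ℕ} {Ω V : Type} [Fintype Ω] [AddCommGroup V]
    (S : RandomSketch n Ω V) (seed : (Fin b → Bool) → Ω)
    (enc : (Fin b → Bool) × V → (Fin k → Bool)) (s : Fin k → Bool) (u : TurnstileUpdate n M) :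
    Fin k → Bool :=
  enc ((Function.invFun enc s).1,
    (Function.invFun enc s).2 + (u.2 : ℤ) • S.col (seed (Function.invFun enc s).1) u.1)

/-- Decode the encoded pair of a seed name and a sketch. -/
noncomputable def sketchReport {n b k : ℕ} {Ω V : Type} [Fintype Ω] [AddCommGroup V]
    (S : RandomSketch n Ω V) (seed : (Fin b → Bool) → Ω)
    (enc : (Fin b → Bool) × V → (Fin k → Bool)) (s : Fin k → Bool) : Option (Fin n) :=
  S.decode (seed (Function.invFun enc s).1) (Function.invFun enc s).2

/-- The streaming algorithm that draws and stores the name of one of `2 ^ b` seeds and maintains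
the sketch for this seed, both encoded in bits by `enc`. -/
noncomputable def sketchSampler {n b k : ℕ} (M : ℕ) {Ω V : Type} [Fintype Ω] [AddCommGroup V]
    (S : RandomSketch n Ω V) (seed : (Fin b → Bool) → Ω)
    (enc : (Fin b → Bool) × V → (Fin k → Bool)) : StreamingSampler n M where
  memBits := k
  coinBits := b
  init w := enc (w, 0)
  update s u _ := sketchUpdate S seed enc s u
  report s _ := sketchReport S seed enc s

section

variable {n M b k : ℕ} {Ω V : Type} [Fintype Ω] [AddCommGroup V] (S : RandomSketch n Ω V)
  (seed : (Fin b → Bool) → Ω) {enc : (Fin b → Bool) × V → (Fin k → Bool)}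

theorem foldl_sketchUpdate (henc : Function.Injective enc) (L : List (TurnstileUpdate n M))
    (w : Fin b → Bool) (v : V) :
    L.foldl (sketchUpdate S seed enc) (enc (w, v))
      = enc (w, v + ∑ i, streamVector L i • S.col (seed w) i) := by
  induction L generalizing v with
  | nil => simp only [List.foldl_nil, streamVector_nil, zero_smul, Finset.sum_const_zero, add_zero]
  | cons u L ih =>
    have h : sketchUpdate S seed enc (enc (w, v)) u
        = enc (w, v + (u.2 : ℤ) • S.col (seed w) u.1) := by
      simp only [sketchUpdate, Function.leftInverse_invFun henc (w, v)]
    rw [List.foldl_cons, h, ih, sum_streamVector_cons_smul, add_assoc]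

theorem sketchSampler_output (henc : Function.Injective enc) (L : List (TurnstileUpdate n M)) :
    (sketchSampler M S seed enc).output L
      = (PMF.uniformOfFintype (Fin b → Bool)).map fun w => S.out (streamVector L) (seed w) := by
  have h : ∀ w : Fin b → Bool,
      sketchReport S seed enc (L.foldl (sketchUpdate S seed enc) (enc (w, 0)))
        = S.out (streamVector L) (seed w) := by
    intro w
    rw [foldl_sketchUpdate S seed henc, zero_add, sketchReport,
      Function.leftInverse_invFun henc _]
    rfl
  exact ((sketchSampler M S seed enc).output_eq_map (upd := sketchUpdate S seed enc)
    (rep := sketchReport S seed enc) (fun _ _ _ => rfl) (fun _ _ => rfl) L).trans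
    (congrArg (fun f => (PMF.uniformOfFintype (Fin b → Bool)).map f) (funext h))

theorem sketchSampler_output_toReal (henc : Function.Injective enc)
    (L : List (TurnstileUpdate n M)) (o : Option (Fin n)) :
    ((sketchSampler M S seed enc).output L o).toReal
      = lawOf (fun _ => (Fintype.card (Fin b → Bool) : ℝ)⁻¹)
        (fun w => S.out (streamVector L) (seed w)) o := by
  classical
  rw [sketchSampler_output S seed henc, PMF.map_apply, tsum_fintype, lawOf_eq,
    ENNReal.toReal_sum]
  · refine Finset.sum_congr rfl fun w _ => ?_
    by_cases h : o = S.out (streamVector L) (seed w)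
    · simp [← h]
    · rw [if_neg h, if_neg (Ne.symm h), ENNReal.toReal_zero]
  · intro w _
    split_ifs
    · exact PMF.apply_ne_top _ _
    · simp

end

/-- The memory holds the seed name (b bits) and the sketch (s bits); another b bits are the coins
that draw the name. As the sketch takes values in a group, only the final vector has to be bounded
by B. -/
theorem exists_sampler_of_sketch {n B b s : ℕ} {Ω V : Type} [Fintype Ω] [AddCommGroup V]
    [Fintype V] (S : RandomSketch n Ω V) (hV : Fintype.card V ≤ 2 ^ s) {ε : ℝ} (hε : 0 < ε)
    (hε1 : ε ≤ 1)
    (hb : 4 * Real.log (2 * (2 * B + 1) ^ n * (n + 1)) ≤ 2 ^ b * ε ^ 2) (M : ℕ) :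
    ∃ A : StreamingSampler n M, A.space = 2 * b + s ∧ ∀ L : List (TurnstileUpdate n M),
      (∀ i, |streamVector L i| ≤ B) →
      ∀ o, |(A.output L o).toReal - S.prob (streamVector L) o| ≤ ε := by
  classical
  have hcard : Fintype.card ((Fin b → Bool) × V) ≤ Fintype.card (Fin (b + s) → Bool) := by
    simp only [Fintype.card_prod, Fintype.card_fun, Fintype.card_bool, Fintype.card_fin, pow_add]
    exact Nat.mul_le_mul_left _ hV
  obtain ⟨enc⟩ := Function.Embedding.nonempty_of_card_le hcard
  obtain ⟨seed, hseed⟩ := exists_sample_law_approx (ι := Fin b → Bool)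
    (X := Fin n → Finset.Icc (-(B : ℤ)) (B : ℤ)) S.weight_nonneg S.sum_weight
    (fun ω x => S.out (fun i => x i) ω) hε hε1 (by
      refine le_trans (le_of_eq ?_) (hb.trans (le_of_eq ?_))
      · have : ((B : ℤ) + 1 + B).toNat = 2 * B + 1 := by omega
        simp [this]
      · simp)
  refine ⟨sketchSampler M S seed enc, ?_, fun L hL o => ?_⟩
  · change b + s + b = _
    ring
  · rw [sketchSampler_output_toReal S seed enc.injective]
    exact hseed (fun i => ⟨streamVector L i, Finset.mem_Icc.2 (abs_le.1 (hL i))⟩) o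

/-! ### Perfect sampling for capped powers -/

theorem capFunction_zero (T p : ℝ) : capFunction T p 0 = 0 := by simp [capFunction]

theorem capFunction_le {T : ℝ} (hT : 0 < T) (p z : ℝ) : capFunction T p z ≤ T := by
  unfold capFunction
  split_ifs
  · exact hT.le
  · exact min_le_left _ _

theorem one_div_max_le_capFunction_div {T p : ℝ} (hT : 0 < T) (hp : 0 ≤ p) {z : ℤ} (hz : z ≠ 0) :
    1 / max 1 T ≤ capFunction T p z / T := by
  have hz' : (z : ℝ) ≠ 0 := by exact_mod_cast hz
  have h1 : (1 : ℝ) ≤ |(z : ℝ)| := by exact_mod_cast Int.one_le_abs hz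
  have h2 : (1 : ℝ) ≤ |(z : ℝ)| ^ p := Real.one_le_rpow h1 hp
  have hm : 0 < max 1 T := by positivity
  rw [capFunction, if_neg hz', div_le_div_iff₀ hm hT, one_mul]
  rcases le_total T (|(z : ℝ)| ^ p) with h | h
  · rw [min_eq_left h]
    nlinarith [le_max_left 1 T]
  · rw [min_eq_right h]
    nlinarith [le_max_right 1 T]

/-- For n = 1 the space bound is log² 1 = 0, and the constant output is exact. -/
theorem StreamingSampler.exists_perfect_one (M m : ℕ) (T p c : ℝ) :
    ∃ A : StreamingSampler 1 M, A.space = 0 ∧ A.IsPerfectSampler (capFunction T p) c 0.99 m := by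
  refine ⟨⟨0, 0, fun _ => Fin.elim0, fun s _ _ => s, fun _ _ => some 0⟩, rfl, fun L _ hpos => ?_⟩
  set A : StreamingSampler 1 M := ⟨0, 0, fun _ => Fin.elim0, fun s _ _ => s, fun _ _ => some 0⟩
    with hA
  have hout : A.output L = PMF.pure (some 0) := by
    rw [A.output_eq_map (upd := fun s _ => s) (rep := fun _ => some 0) (fun _ _ _ => rfl)
      (fun _ _ => rfl)]
    exact PMF.map_const _ _
  have hs : A.successProb L = 1 := by simp [StreamingSampler.successProb, hout]
  refine ⟨by rw [hs]; norm_num, fun i => ?_⟩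
  obtain rfl : i = 0 := Subsingleton.elim _ _
  rw [StreamingSampler.condProb, hs, hout]
  simp only [Fin.sum_univ_one, Fin.isValue] at hpos ⊢
  rw [div_self hpos.ne']
  simp

/-- Failure has probability at most 1/256 + 1/400 < 0.01. The output probability of i differs from
`successProb` times the target by at most 2(δ + ε), and dividing by `successProb` ≥ 0.99 keeps this
below n^(-c). -/
theorem StreamingSampler.isPerfectSampler_of_near {n M m B : ℕ} (A : StreamingSampler n M)
    {Ω V : Type} [Fintype Ω] [AddCommGroup V] (S : RandomSketch n Ω V) {G : ℝ → ℝ} (hG0 : G 0 = 0)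
    (hG : ∀ z : ℤ, 0 ≤ G z) {T : ℝ} (hT : 0 < T) {δ ε c : ℝ} (hc : 0 ≤ c) (hn : 1 ≤ n)
    (hS : S.IsNearSampler (fun z => G z / T) B δ)
    (hB : ∀ L : List (TurnstileUpdate n M), L.length ≤ m → ∀ i, |streamVector L i| ≤ B)
    (hA : ∀ L : List (TurnstileUpdate n M), (∀ i, |streamVector L i| ≤ B) →
      ∀ o, |(A.output L o).toReal - S.prob (streamVector L) o| ≤ ε)
    (hδ : δ + ε ≤ (n : ℝ) ^ (-c) / 400) : A.IsPerfectSampler G c 0.99 m := by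
  intro L hL hpos
  have hBL := hB L hL
  have hx0 : streamVector L ≠ 0 := by
    intro h
    simp [h, hG0] at hpos
  obtain ⟨N, hN0, hN1, hnone, hsome⟩ := hS _ hBL hx0
  have hn1 : (n : ℝ) ^ (-c) ≤ 1 :=
    Real.rpow_le_one_of_one_le_of_nonpos (by exact_mod_cast hn) (by linarith)
  have h1 := abs_le.1 ((abs_sub_le _ _ _).trans (add_le_add (hA L hBL none) hnone))
  have hs1 : 0.99 ≤ A.successProb L := by
    rw [StreamingSampler.successProb]
    linarith [h1.2]
  refine ⟨hs1, fun i => ?_⟩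
  set π := G (streamVector L i) / ∑ j, G (streamVector L j) with hπ
  have hπ0 : 0 ≤ π := div_nonneg (hG _) hpos.le
  have hπ1 : π ≤ 1 := by
    rw [hπ, div_le_one hpos]
    exact Finset.single_le_sum (f := fun j => G (streamVector L j)) (fun j _ => hG _)
      (Finset.mem_univ i)
  have h2 := (abs_sub_le _ _ _).trans (add_le_add (hA L hBL (some i)) (hsome i))
  rw [← Finset.sum_div, div_div_div_cancel_right₀ hT.ne', ← hπ] at h2
  have h2 := abs_le.1 h2
  rw [zero_mul, zero_add, StreamingSampler.condProb, abs_le]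
  have hs0 : 0 < A.successProb L := by linarith
  have hsub : A.successProb L - (1 - N) = -((A.output L none).toReal - N) := by
    rw [StreamingSampler.successProb]; ring
  have h3 : |(A.successProb L - (1 - N)) * π| ≤ ε + δ := by
    rw [hsub, abs_mul, abs_neg, abs_of_nonneg hπ0]
    calc _ ≤ (ε + δ) * 1 :=
          mul_le_mul (abs_le.2 h1) hπ1 hπ0 ((abs_nonneg _).trans (abs_le.2 h1))
      _ = _ := mul_one _
  have h3 := abs_le.1 h3
  have hb0 : 0 ≤ (n : ℝ) ^ (-c) := by positivity
  constructor
  · rw [neg_le_sub_iff_le_add, ← sub_le_iff_le_add, le_div_iff₀ hs0]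
    nlinarith
  · rw [sub_le_iff_le_add, div_le_iff₀ hs0]
    nlinarith

/-! ### Numerical estimates and choice of parameters -/

theorem nat_log_succ_le_three_mul_log {n : ℕ} (hn : 2 ≤ n) :
    ((Nat.log 2 n + 1 : ℕ) : ℝ) ≤ 3 * Real.log n := by
  have h2 : (2 : ℝ) ^ Nat.log 2 n ≤ n := by exact_mod_cast Nat.pow_log_le_self 2 (by omega)
  have h3 := Real.log_le_log (by positivity) h2
  rw [Real.log_pow] at h3
  have h4 : Real.log 2 ≤ Real.log n := Real.log_le_log (by norm_num) (by exact_mod_cast hn)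
  have h5 := Real.log_two_gt_d9
  push_cast
  nlinarith

/-- The number of inputs is exponential in n, but the seed count depends only on its logarithm,
which is polynomial in N. -/
theorem four_mul_log_le_pow {n N a : ℕ} (hnN : n < N) (hN : 4 ≤ N) :
    4 * Real.log (2 * (2 * (N ^ (2 * a) : ℕ) + 1) ^ n * (n + 1)) ≤ (N : ℝ) ^ (2 * a + 6) := by
  have hle : 2 * (2 * N ^ (2 * a) + 1) ^ n * (n + 1) ≤ N ^ ((2 * a + 1) * n + 2) := by
    have h1 : 2 * N ^ (2 * a) + 1 ≤ N ^ (2 * a + 1) := by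
      have : 1 ≤ N ^ (2 * a) := Nat.one_le_pow _ _ (by omega)
      rw [pow_succ]; nlinarith
    calc _ ≤ N * (N ^ (2 * a + 1)) ^ n * N := by gcongr <;> omega
      _ = _ := by rw [← pow_mul]; ring
  have hN0 : (0 : ℝ) < N := by exact_mod_cast (show 0 < N by omega)
  have hlog : Real.log (2 * (2 * (N ^ (2 * a) : ℕ) + 1) ^ n * (n + 1))
      ≤ ((2 * a + 1) * n + 2 : ℕ) * Real.log N := by
    rw [← Real.log_pow]
    refine Real.log_le_log (by positivity) ?_
    exact_mod_cast hle
  have hlogN : Real.log N ≤ N := (Real.log_le_sub_one_of_pos hN0).trans (by linarith)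
  have hfin : 4 * (((2 * a + 1) * n + 2) * N) ≤ N ^ (2 * a + 6) := by
    have h1 : 2 * a + 3 ≤ N ^ (2 * a + 3) := (Nat.lt_pow_self (by omega)).le
    calc 4 * (((2 * a + 1) * n + 2) * N) ≤ N * (((2 * a + 1) * N + 2 * N) * N) := by
          gcongr; omega
      _ = (2 * a + 3) * N ^ 3 := by ring
      _ ≤ N ^ (2 * a + 3) * N ^ 3 := Nat.mul_le_mul_right _ h1
      _ = _ := by ring
  calc _ ≤ 4 * (((2 * a + 1) * n + 2 : ℕ) * (N : ℝ)) := by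
        gcongr
        exact hlog.trans (by gcongr)
    _ ≤ _ := by exact_mod_cast hfin

theorem cell_error_le {n N a d l q R : ℕ} (hnN : n < N) (hN : 4 ≤ N) (hl : l + 2 ≤ N)
    (hR : R ≤ 65 * n) (hq : N ^ (2 * a + d + 14) < q) :
    2 * ((R : ℝ) * (l + 2)) * (n * (2 * (N ^ (2 * a) : ℕ) + 1) / q) ≤ ((N : ℝ) ^ (d + 5))⁻¹ := by
  have hq0 : (0 : ℝ) < q := by exact_mod_cast (show 0 < q by omega)
  have hN0 : (0 : ℝ) < N := by exact_mod_cast (show 0 < N by omega)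
  have key : 2 * (R * (l + 2)) * (n * (2 * N ^ (2 * a) + 1)) * N ^ (d + 5)
      ≤ N ^ (2 * a + d + 14) := by
    have h1 : 2 * N ^ (2 * a) + 1 ≤ N ^ (2 * a + 1) := by
      have : 1 ≤ N ^ (2 * a) := Nat.one_le_pow _ _ (by omega)
      rw [pow_succ]; nlinarith
    have h2 : 130 ≤ N ^ 4 := le_trans (by norm_num) (Nat.pow_le_pow_left hN 4)
    calc _ ≤ 2 * ((65 * N) * N) * (N * N ^ (2 * a + 1)) * N ^ (d + 5) := by
          gcongr; omega
      _ = 130 * N ^ (2 * a + d + 9) := by ring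
      _ ≤ N ^ 4 * N ^ (2 * a + d + 9) := Nat.mul_le_mul_right _ h2
      _ = N ^ (2 * a + d + 13) := by ring
      _ ≤ _ := Nat.pow_le_pow_right (by omega) (by omega)
  rw [← mul_div_assoc, div_le_iff₀ hq0, inv_mul_eq_div, le_div_iff₀ (by positivity)]
  exact_mod_cast key.trans hq.le

theorem mainTheorem7 (c : ℝ) (hc : 0 < c) (κ : ℝ) :
    ∃ C : ℝ, 0 < C ∧
      ∀ (p T : ℝ), 0 ≤ p → 0 < T →
      ∀ (n m M : ℕ), 1 ≤ n → (m : ℝ) ≤ (n : ℝ) ^ κ → (M : ℝ) ≤ (n : ℝ) ^ κ →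
        ∃ A : StreamingSampler n M,
          (A.space : ℝ) ≤ C * max 1 T * Real.log n ^ 2 ∧
          A.IsPerfectSampler (capFunction T p) c 0.99 m := by
  obtain ⟨a, ha⟩ := exists_nat_ge κ
  obtain ⟨d, hd⟩ := exists_nat_ge c
  set α := 2 * a + d + 14 with hα
  refine ⟨9 * (2 * (2 * a + 2 * d + 16) + 130 * (α + 1)), by positivity, ?_⟩
  intro p T hp hT n m M hn hm hM
  rcases hn.eq_or_lt with rfl | hn2
  · obtain ⟨A, hA, hA'⟩ := StreamingSampler.exists_perfect_one M m T p c
    exact ⟨A, by simp [hA], hA'⟩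
  set τ := max 1 T with hτ
  have hτ1 : 1 ≤ τ := le_max_left _ _
  set l := Nat.log 2 n + 1 with hl
  set N := 2 ^ l with hNdef
  have hlog1 : 1 ≤ Nat.log 2 n := Nat.log_pos (by norm_num) hn2
  have hl2 : 2 ≤ l := by omega
  have hnN : n < N := Nat.lt_pow_succ_log_self (by norm_num) n
  have hN4 : 4 ≤ N := Nat.pow_le_pow_right (n := 2) (by norm_num) hl2
  have hlN : l + 2 ≤ N := by
    obtain ⟨j, hj⟩ := Nat.exists_eq_add_of_le hl2
    have := (Nat.lt_two_pow_self (n := j))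
    rw [hNdef, hj, pow_add]; omega
  have hN0 : (0 : ℝ) < N := by exact_mod_cast (show 0 < N by omega)
  set B := N ^ (2 * a) with hB
  have hpoly : ∀ k : ℕ, (k : ℝ) ≤ (n : ℝ) ^ κ → k ≤ N ^ a := by
    intro k hk
    have h1 : (n : ℝ) ^ κ ≤ (n : ℝ) ^ (a : ℝ) :=
      Real.rpow_le_rpow_of_exponent_le (by exact_mod_cast hn) ha
    rw [Real.rpow_natCast] at h1
    have h2 : k ≤ n ^ a := by exact_mod_cast hk.trans h1
    exact h2.trans (Nat.pow_le_pow_left hnN.le a)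
  have hbound : ∀ L : List (TurnstileUpdate n M), L.length ≤ m →
      ∀ i, |streamVector L i| ≤ B := by
    intro L hL i
    refine (abs_streamVector_le L i).trans ?_
    have h1 : L.length * M ≤ N ^ a * N ^ a := Nat.mul_le_mul (hL.trans (hpoly m hm)) (hpoly M hM)
    rw [← pow_add, ← two_mul] at h1
    exact_mod_cast h1
  -- Bertrand's postulate: q exceeds N^α, as `cell_error_le` requires, yet an element of `ZMod q`
  -- fits in α l + 1 bits.
  obtain ⟨q, hqp, hq1, hq2⟩ := Nat.exists_prime_lt_and_le_two_mul (N ^ α) (by positivity)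
  have : Fact q.Prime := ⟨hqp⟩
  have hqB : 2 * B < q := by
    refine lt_of_le_of_lt ?_ hq1
    calc 2 * B ≤ N ^ (2 * a + 1) := by rw [pow_succ, mul_comm]; gcongr; omega
      _ ≤ N ^ α := Nat.pow_le_pow_right (by omega) (by omega)
  have hq3 : ∀ K : ℕ, q ^ K ≤ 2 ^ ((α * l + 1) * K) := by
    intro K
    rw [pow_mul]
    refine Nat.pow_le_pow_left (hq2.trans (le_of_eq ?_)) K
    rw [hNdef, ← pow_mul, pow_succ]; ring
  set g : ℤ → ℝ := fun z => capFunction T p z / T with hg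
  have hgz : g 0 = 0 := by simp [hg, capFunction_zero]
  have hg1 : ∀ z, g z ≤ 1 := fun z => (div_le_one hT).2 (capFunction_le hT _ _)
  have hgτ : ∀ z, z ≠ 0 → 1 / τ ≤ g z := fun z hz => one_div_max_le_capFunction_div hT hp hz
  have hgp : ∀ z, z ≠ 0 → 0 < g z := fun z hz => lt_of_lt_of_le (by positivity) (hgτ z hz)
  have hg0 : ∀ z, 0 ≤ g z := by
    intro z
    by_cases hz : z = 0
    · rw [hz, hgz]
    · exact (hgp z hz).le
  have hG0 : ∀ z : ℤ, 0 ≤ capFunction T p z := fun z => by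
    have h1 : capFunction T p z = g z * T := by simp [hg, hT.ne']
    rw [h1]; exact mul_nonneg (hg0 z) hT.le
  set ε : ℝ := ((N : ℝ) ^ (d + 5))⁻¹ with hε
  have hε0 : 0 < ε := by positivity
  have hε1 : ε ≤ 1 := inv_le_one_of_one_le₀ (one_le_pow₀ (by exact_mod_cast (by omega : 1 ≤ N)))
  have hsketch : ∃ (Ω V : Type) (_ : Fintype Ω) (_ : AddCommGroup V) (_ : Fintype V)
      (S : RandomSketch n Ω V) (K : ℕ) (δ : ℝ), Fintype.card V ≤ 2 ^ ((α * l + 1) * K) ∧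
      (K : ℝ) ≤ 130 * τ * l ∧ δ ≤ ε ∧ S.IsNearSampler g B δ := by
    -- The accumulated collision error grows with the number R of repetitions, so a polynomial q
    -- suffices only while τ ≤ n. For larger T, the n residues fit into the budget K ≤ 130 τ l.
    rcases le_or_gt T n with hTn | hTn
    · have hτn : τ ≤ n := max_le (by exact_mod_cast hn) hTn
      set R := ⌈64 * τ⌉₊ with hR
      have hR1 : (R : ℝ) ≤ 65 * τ := by
        have := Nat.ceil_lt_add_one (show (0 : ℝ) ≤ 64 * τ by positivity)
        linarith
      obtain ⟨Ω, V, i1, i2, i3, S, hcard, hS⟩ := exists_nearSampler_of_cells (R := R) hqB hnN g hgz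
        hg1 hτ1 hgτ (Nat.le_ceil _)
      refine ⟨Ω, V, i1, i2, i3, S, R * (l + 2), _, hcard.le.trans (hq3 _), ?_, ?_, hS⟩
      · have h1 : (2 : ℝ) ≤ l := by exact_mod_cast hl2
        push_cast
        calc (R : ℝ) * (l + 2) ≤ (65 * τ) * (l + l) := by gcongr
          _ = _ := by ring
      · refine cell_error_le hnN hN4 hlN ?_ hq1
        have : (R : ℝ) ≤ 65 * n := by linarith
        exact_mod_cast this
    · obtain ⟨Ω, V, i1, i2, i3, S, hcard, hS⟩ := exists_nearSampler_of_storing hqB hn g hg0 hgp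
      refine ⟨Ω, V, i1, i2, i3, S, n, 0, hcard.le.trans (hq3 _), ?_, hε0.le, hS⟩
      have h1 : (2 : ℝ) ≤ l := by exact_mod_cast hl2
      have h2 : (n : ℝ) ≤ τ := hTn.le.trans (le_max_right _ _)
      nlinarith
  obtain ⟨Ω, V, i1, i2, i3, S, K, δ, hcard, hK, hδ, hS⟩ := hsketch
  -- This b gives 2^b ε² = N^(2a+2d+16) / N^(2d+10) = N^(2a+6), the bound in `four_mul_log_le_pow`.
  obtain ⟨A, hspace, hA⟩ := exists_sampler_of_sketch (B := B) (b := (2 * a + 2 * d + 16) * l) S hcard hε0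
    hε1 (by
      refine (four_mul_log_le_pow (a := a) hnN hN4).trans (le_of_eq ?_)
      have h1 : (2 : ℝ) ^ ((2 * a + 2 * d + 16) * l) = (N : ℝ) ^ (2 * a + 2 * d + 16) := by
        rw [hNdef, mul_comm, pow_mul]; push_cast; rfl
      rw [h1, hε, inv_pow, ← pow_mul, ← div_eq_mul_inv, eq_div_iff (by positivity), ← pow_add]
      congr 1
      ring) M
  refine ⟨A, ?_, A.isPerfectSampler_of_near S (capFunction_zero T p) hG0 hT hc.le hn hS hbound hA
    ?_⟩
  · rw [hspace]
    have hl3 : (l : ℝ) ≤ 3 * Real.log n := nat_log_succ_le_three_mul_log hn2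
    have hl1 : (1 : ℝ) ≤ l := by exact_mod_cast (by omega : 1 ≤ l)
    have hll : (l : ℝ) ^ 2 ≤ 9 * Real.log n ^ 2 := by nlinarith
    have h1 : (l : ℝ) ≤ τ * l ^ 2 := by nlinarith
    have h2 : (α * l + 1 : ℝ) * K ≤ ((α + 1) * l) * (130 * τ * l) := by
      have : (α * l + 1 : ℝ) ≤ (α + 1) * l := by linarith
      exact mul_le_mul this hK (by positivity) (by positivity)
    calc ((2 * ((2 * a + 2 * d + 16) * l) + (α * l + 1) * K : ℕ) : ℝ)
        = 2 * (2 * a + 2 * d + 16) * l + (α * l + 1) * K := by push_cast; ring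
      _ ≤ 2 * (2 * a + 2 * d + 16) * (τ * l ^ 2) + ((α + 1) * l) * (130 * τ * l) := by gcongr
      _ = (2 * (2 * a + 2 * d + 16) + 130 * (α + 1)) * τ * l ^ 2 := by ring
      _ ≤ (2 * (2 * a + 2 * d + 16) + 130 * (α + 1)) * τ * (9 * Real.log n ^ 2) := by gcongr
      _ = _ := by ring
  · have hn0 : (0 : ℝ) < n := by exact_mod_cast hn
    have h1 : ((N : ℝ) ^ d)⁻¹ ≤ (n : ℝ) ^ (-c) := by
      rw [Real.rpow_neg hn0.le]
      refine inv_anti₀ (by positivity) ?_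
      calc (n : ℝ) ^ c ≤ (n : ℝ) ^ (d : ℝ) :=
            Real.rpow_le_rpow_of_exponent_le (by exact_mod_cast hn) hd
        _ = (n : ℝ) ^ d := Real.rpow_natCast _ _
        _ ≤ _ := by gcongr
    -- The factor N^5 ≥ 4^5 in 1/ε absorbs the constant: δ + ε ≤ 2ε must be at most n^(-c)/400.
    have h2 : ((N : ℝ) ^ 5)⁻¹ ≤ 1 / 800 := by
      rw [inv_le_comm₀ (by positivity) (by norm_num)]
      calc (1 / 800 : ℝ)⁻¹ ≤ 4 ^ 5 := by norm_num
        _ ≤ (N : ℝ) ^ 5 := by gcongr; exact_mod_cast hN4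
    have h3 : ε ≤ (n : ℝ) ^ (-c) * (1 / 800) := by
      rw [hε, pow_add, mul_inv]
      exact mul_le_mul h1 h2 (by positivity) (by positivity)
    linarith
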